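/- \textbf{Definitions.} A \emph{scwol} is a small category in which every endomorphism is an identity; it need not be skeletal, and it is finite if it has finitely many objects and morphisms. An \emph{action} of a group $G$ on a scwol $X$ is a group homomorphism from $G$ to the group of strictly invertible functors $X\to X$ such that for every non-identity morphism $a\colon s(a)\to t(a)$ and every $g\in G$: (i) $g\,s(a)\neq t(a)$, and (ii) if $g\,s(a)=s(a)$ then $ga=a$. The \emph{quotient scwol} $X/G$ has as objects and morphisms the $G$-orbits of objects and of morphisms of $X$, with the induced source, target, composition and identities. Let $R$ be an associative commutative ring with identity. For a small category $\Gamma$, an $R\Gamma$-module is a contravariant functor from $\Gamma$ to $R$-modules; it is finitely generated if it is a quotient of a finite direct sum of modules $R\,\mathrm{mor}_\Gamma(?,x)$. For an object $x$, $S_xM$ is the quotient of $M(x)$ by the submodule generated by the images of all $M(u)\colon M(y)\to M(x)$ with $u\colon x\to y$ non-invertible. Write $R[x]$ for the group ring $R\,\mathrm{Aut}(x)$. $\Gamma$ is \emph{of type (FP$_R$)} if the constant $R\Gamma$-module $\underline R$ has a projective resolution $P_*$ of finite length by finitely generated modules; in that case, given a rank $\mathrm{rk}_R(N)\in\mathbb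 Z$ for finitely generated $R$-modules with $\mathrm{rk}_R(R)=1$ that is additive on short exact sequences of finitely generated modules, $$\chi(\Gamma;R)=\sum_{\bar x\in\mathrm{iso}(\Gamma)}\ \sum_{n\ge 0}(-1)^n\,\mathrm{rk}_R\bigl(S_xP_n\otimes_{R[x]}R\bigr).$$ If all automorphism groups of $\Gamma$ are finite (as for scwols, where they are trivial), then $\Gamma$ is \emph{of type ($L^2$)} if $\sum_{\bar x}\sum_n b_n(x)<\infty$, where $b_n(x)=\dim_{\mathbb C}H_n(S_xP_*)/|\mathrm{Aut}(x)|$ for a (not necessarily finite) projective resolution $P_*$ of $\underline{\mathbb C}$; in that case $\chi^{(2)}(\Gamma)=\sum_{\bar x}\sum_n(-1)^n b_n(x)$. \textbf{Theorem.} Let $G$ be a finite group acting on a finite scwol $X$, and suppose that $G$ acts freely on the objects of $X$. Then $X$ and $X/G$ are of type (FP$_R$) for every associative commutative ring $R$ with identity, they are of type ($L^2$), and $$\chi(X/G;R)=\frac{\chi(X;R)}{|G|}\qquad\text{and}\qquad \chi^{(2)}(X/G)=\frac{\chi^{(2)}(X)}{|G|}$$ for every $R$ equipped with a rank as above. Moreover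 $\chi(X;R)=\chi^{(2)}(X)$ and $\chi(X/G;R)=\chi^{(2)}(X/G)$. -/

import Mathlib

open CategoryTheory Opposite
open scoped ENNReal

universe u w

noncomputable section

/-! ### Scwols and group actions on them -/

/-- A small category without loops: every endomorphism is an identity.
Scwols are not required to be skeletal. -/
class IsScwol (X : Type*) [Category X] : Prop where
  endo_eq_id : ∀ (x : X) (f : x ⟶ x), f = 𝟙 x

/-- The morphism `a` is an identity morphism ("trivial"). -/
def IsTrivialMor {X : Type*} [Category X] {x y : X} (a : x ⟶ y) : Prop :=
  ∃ h : x = y, a = eqToHom h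

/-- An action of a group `G` on a scwol `X`: a homomorphism from `G` to the group of strictly
invertible functors `X ⥤ X` (the fields `act`, `act_one`, `act_mul`, which force each `act g` to be
strictly invertible with inverse `act g⁻¹`), such that for each nontrivial morphism `a` and `g ∈ G`,
`g s(a) ≠ t(a)`, and `g s(a) = s(a)` implies `g a = a`. -/
structure ScwolAction (G : Type*) [Group G] (X : Type*) [Category X] where
  act : G → X ⥤ X
  act_one : act 1 = 𝟭 X
  act_mul : ∀ g h : G, act (g * h) = act h ⋙ act g
  source_ne_target : ∀ (g : G) {x y : X} (a : x ⟶ y), ¬ IsTrivialMor a → (act g).obj x ≠ y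
  fix_of_fix_source : ∀ (g : G) {x y : X} (a : x ⟶ y), ¬ IsTrivialMor a →
    (act g).obj x = x → Arrow.mk ((act g).map a) = Arrow.mk a

namespace ScwolAction

variable {G : Type*} [Group G] {X : Type*} [Category X] (A : ScwolAction G X)

/-- `G` acts freely on the set of objects. -/
def IsFreeOnObjects : Prop :=
  ∀ (g : G) (x : X), (A.act g).obj x = x → g = 1

/-- The induced action on the set of all morphisms. -/
def actArrow (g : G) (a : Arrow X) : Arrow X := Arrow.mk ((A.act g).map a.hom)

theorem obj_one (x : X) : (A.act 1).obj x = x := by rw [A.act_one]; rfl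

theorem obj_mul (g h : G) (x : X) : (A.act (g * h)).obj x = (A.act g).obj ((A.act h).obj x) := by
  rw [A.act_mul]; rfl

theorem actArrow_one (a : Arrow X) : A.actArrow 1 a = a := by
  unfold actArrow; rw [A.act_one]; rfl

theorem actArrow_mul (g h : G) (a : Arrow X) :
    A.actArrow (g * h) a = A.actArrow g (A.actArrow h a) := by
  unfold actArrow; rw [A.act_mul]; rfl

/-- Two objects are equivalent if they lie in the same `G`-orbit. -/
def objSetoid : Setoid X where
  r x y := ∃ g : G, (A.act g).obj x = y
  iseqv :=
    { refl := fun x => ⟨1, A.obj_one x⟩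
      symm := by
        rintro x y ⟨g, rfl⟩
        exact ⟨g⁻¹, by rw [← A.obj_mul, inv_mul_cancel, A.obj_one]⟩
      trans := by
        rintro x y z ⟨g, rfl⟩ ⟨h, rfl⟩
        exact ⟨h * g, A.obj_mul h g x⟩ }

/-- Two morphisms are equivalent if they lie in the same `G`-orbit. -/
def morSetoid : Setoid (Arrow X) where
  r a b := ∃ g : G, A.actArrow g a = b
  iseqv :=
    { refl := fun a => ⟨1, A.actArrow_one a⟩
      symm := by
        rintro a b ⟨g, rfl⟩
        exact ⟨g⁻¹, by rw [← A.actArrow_mul, inv_mul_cancel, A.actArrow_one]⟩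
      trans := by
        rintro a b c ⟨g, rfl⟩ ⟨h, rfl⟩
        exact ⟨h * g, A.actArrow_mul h g a⟩ }

/-- The objects of the quotient scwol `X / G`: the `G`-orbits of objects of `X`. -/
def QuotientScwol : Type _ := Quotient A.objSetoid

/-- The morphisms of the quotient scwol `X / G`: the `G`-orbits of morphisms of `X`. -/
def QuotientMor : Type _ := Quotient A.morSetoid

/-- The projection on objects. -/
def projObj (x : X) : A.QuotientScwol := Quotient.mk A.objSetoid x

theorem exists_projObj (p : A.QuotientScwol) : ∃ x : X, p = A.projObj x :=
  Quotient.inductionOn p fun x => ⟨x, rfl⟩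

/-- The projection on morphisms. -/
def projMor (a : Arrow X) : A.QuotientMor := Quotient.mk A.morSetoid a

/-- Source of a morphism of `X / G`. -/
def src : A.QuotientMor → A.QuotientScwol :=
  Quotient.lift (fun a : Arrow X => A.projObj a.left) (by
    rintro a b ⟨g, rfl⟩
    exact Quotient.sound (s := A.objSetoid) ⟨g, rfl⟩)

/-- Target of a morphism of `X / G`. -/
def tgt : A.QuotientMor → A.QuotientScwol :=
  Quotient.lift (fun a : Arrow X => A.projObj a.right) (by
    rintro a b ⟨g, rfl⟩
    exact Quotient.sound (s := A.objSetoid) ⟨g, rfl⟩)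

/-- Morphisms `p ⟶ q` of `X / G`. -/
def QuotientHom (p q : A.QuotientScwol) : Type _ :=
  {m : A.QuotientMor // A.src m = p ∧ A.tgt m = q}

/-- The class of a morphism of `X`, as a morphism of `X / G`. -/
def homMk {x y : X} (a : x ⟶ y) : A.QuotientHom (A.projObj x) (A.projObj y) :=
  ⟨A.projMor (Arrow.mk a), rfl, rfl⟩

theorem exists_hom_lift {q : A.QuotientScwol} (x : X) (m : A.QuotientHom (A.projObj x) q) :
    ∃ (y : X) (a : x ⟶ y), A.projObj y = q ∧ m.1 = A.projMor (Arrow.mk a) := by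
  obtain ⟨m, hs, ht⟩ := m
  induction m using Quotient.inductionOn with
  | h b =>
    obtain ⟨g, hg⟩ := Quotient.exact (s := A.objSetoid) hs
    subst hg
    refine ⟨_, (A.act g).map b.hom, ?_, ?_⟩
    · rw [← ht]
      exact (Quotient.sound (s := A.objSetoid) ⟨g, rfl⟩ : A.projObj b.right = _).symm
    · exact Quotient.sound (s := A.morSetoid) ⟨g, rfl⟩

theorem actArrow_eq_of_source (g h : G) {x y : X} (a : x ⟶ y)
    (hx : (A.act g).obj x = (A.act h).obj x) :
    A.actArrow g (Arrow.mk a) = A.actArrow h (Arrow.mk a) := by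
  by_cases ha : IsTrivialMor a
  · obtain ⟨rfl, rfl⟩ := ha
    have key : ∀ k : G, A.actArrow k (Arrow.mk (eqToHom (rfl : x = x)))
        = Arrow.mk (𝟙 ((A.act k).obj x)) := by
      intro k
      simp [actArrow]
    rw [key, key, hx]
  · have h1 : (A.act (h⁻¹ * g)).obj x = x := by
      rw [A.obj_mul, hx, ← A.obj_mul, inv_mul_cancel, A.obj_one]
    have h2 : A.actArrow (h⁻¹ * g) (Arrow.mk a) = Arrow.mk a :=
      A.fix_of_fix_source (h⁻¹ * g) a ha h1
    calc A.actArrow g (Arrow.mk a) = A.actArrow (h * (h⁻¹ * g)) (Arrow.mk a) := by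
          rw [mul_inv_cancel_left]
      _ = A.actArrow h (Arrow.mk a) := by rw [A.actArrow_mul, h2]

theorem arrow_comp_congr {x y z x' y' z' : X} {a : x ⟶ y} {b : y ⟶ z} {a' : x' ⟶ y'} {b' : y' ⟶ z'}
    (ha : Arrow.mk a = Arrow.mk a') (hb : Arrow.mk b = Arrow.mk b') :
    Arrow.mk (a ≫ b) = Arrow.mk (a' ≫ b') := by
  obtain rfl : x = x' := congrArg Comma.left ha
  obtain rfl : y = y' := congrArg Comma.right ha
  obtain rfl : z = z' := congrArg Comma.right hb
  obtain rfl : a = a' := (Arrow.mk_inj _ _).mp ha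
  obtain rfl : b = b' := (Arrow.mk_inj _ _).mp hb
  rfl

/-- The orbit of a composite depends only on the orbits of the factors. -/
theorem projMor_comp_congr {x y z x' y' z' : X} {a : x ⟶ y} {b : y ⟶ z} {a' : x' ⟶ y'}
    {b' : y' ⟶ z'} (ha : A.projMor (Arrow.mk a) = A.projMor (Arrow.mk a'))
    (hb : A.projMor (Arrow.mk b) = A.projMor (Arrow.mk b')) :
    A.projMor (Arrow.mk (a ≫ b)) = A.projMor (Arrow.mk (a' ≫ b')) := by
  obtain ⟨g, hg⟩ := Quotient.exact (s := A.morSetoid) ha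
  obtain ⟨h, hh⟩ := Quotient.exact (s := A.morSetoid) hb
  have e1 : (A.act g).obj y = y' := congrArg Comma.right hg
  have e2 : (A.act h).obj y = y' := congrArg Comma.left hh
  have hgb := (A.actArrow_eq_of_source g h b (e1.trans e2.symm)).trans hh
  refine Quotient.sound (s := A.morSetoid) ⟨g, ?_⟩
  have := arrow_comp_congr (a := (A.act g).map a) (b := (A.act g).map b) hg hgb
  simpa [actArrow] using this

/-- Composites in `X / G` are induced by those in `X`. -/
theorem exists_quotient_comp {p q r : A.QuotientScwol} (m : A.QuotientHom p q)
    (n : A.QuotientHom q r) :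
    ∃ k : A.QuotientHom p r, ∀ (x y z : X) (a : x ⟶ y) (b : y ⟶ z),
      A.projMor (Arrow.mk a) = m.1 → A.projMor (Arrow.mk b) = n.1 →
        k.1 = A.projMor (Arrow.mk (a ≫ b)) := by
  obtain ⟨x, rfl⟩ := A.exists_projObj p
  obtain ⟨y, a, rfl, ha⟩ := A.exists_hom_lift x m
  obtain ⟨z, b, rfl, hb⟩ := A.exists_hom_lift y n
  refine ⟨A.homMk (a ≫ b), fun x' y' z' a' b' ha' hb' => ?_⟩
  exact A.projMor_comp_congr (ha.symm.trans ha'.symm) (hb.symm.trans hb'.symm)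

/-- Composition in `X / G`. -/
def quotientComp {p q r : A.QuotientScwol} (m : A.QuotientHom p q) (n : A.QuotientHom q r) :
    A.QuotientHom p r :=
  (A.exists_quotient_comp m n).choose

theorem quotientComp_val {p q r : A.QuotientScwol} (m : A.QuotientHom p q) (n : A.QuotientHom q r)
    {x y z : X} {a : x ⟶ y} {b : y ⟶ z} (ha : m.1 = A.projMor (Arrow.mk a))
    (hb : n.1 = A.projMor (Arrow.mk b)) :
    (A.quotientComp m n).1 = A.projMor (Arrow.mk (a ≫ b)) :=
  (A.exists_quotient_comp m n).choose_spec x y z a b ha.symm hb.symm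

/-- The identity of `[x]` in `X / G` is the orbit of the identity of `x`. -/
def quotientId (p : A.QuotientScwol) : A.QuotientHom p p :=
  ⟨Quotient.lift (fun x : X => A.projMor (Arrow.mk (𝟙 x))) (by
      rintro x y ⟨g, rfl⟩
      exact Quotient.sound (s := A.morSetoid) ⟨g, by simp [actArrow]⟩) p, by
    obtain ⟨x, rfl⟩ := A.exists_projObj p
    exact ⟨rfl, rfl⟩⟩

theorem quotientId_val (x : X) :
    (A.quotientId (A.projObj x)).1 = A.projMor (Arrow.mk (𝟙 x)) := rfl

/-- The quotient scwol `X / G`. -/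
instance : Category A.QuotientScwol where
  Hom := A.QuotientHom
  id := A.quotientId
  comp := A.quotientComp
  id_comp {p q} m := by
    obtain ⟨x, rfl⟩ := A.exists_projObj p
    obtain ⟨y, a, rfl, ha⟩ := A.exists_hom_lift x m
    apply Subtype.ext
    rw [A.quotientComp_val _ _ (A.quotientId_val x) ha, Category.id_comp, ha]
  comp_id {p q} m := by
    obtain ⟨x, rfl⟩ := A.exists_projObj p
    obtain ⟨y, a, rfl, ha⟩ := A.exists_hom_lift x m
    apply Subtype.ext
    rw [A.quotientComp_val _ _ ha (A.quotientId_val y), Category.comp_id, ha]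
  assoc {p q r s} m n k := by
    obtain ⟨x, rfl⟩ := A.exists_projObj p
    obtain ⟨y, a, rfl, ha⟩ := A.exists_hom_lift x m
    obtain ⟨z, b, rfl, hb⟩ := A.exists_hom_lift y n
    obtain ⟨t, c, rfl, hc⟩ := A.exists_hom_lift z k
    apply Subtype.ext
    rw [A.quotientComp_val _ _ (A.quotientComp_val _ _ ha hb) hc,
      A.quotientComp_val _ _ ha (A.quotientComp_val _ _ hb hc), Category.assoc]

/-- `X / G` is again a scwol. -/
instance : IsScwol A.QuotientScwol where
  endo_eq_id p m := by
    obtain ⟨x, rfl⟩ := A.exists_projObj p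
    obtain ⟨y, a, hy, ha⟩ := A.exists_hom_lift x m
    obtain ⟨g, hg⟩ := Quotient.exact (s := A.objSetoid) hy.symm
    have ht : IsTrivialMor a := by
      by_contra h
      exact A.source_ne_target g a h hg
    obtain ⟨rfl, rfl⟩ := ht
    exact Subtype.ext ha

end ScwolAction

/-- Automorphism groups in a scwol are trivial, in particular finite. -/
instance IsScwol.finite_aut {X : Type*} [Category X] [IsScwol X] (x : X) : Finite (Aut x) := by
  have : Subsingleton (Aut x) :=
    ⟨fun a b => Iso.ext ((IsScwol.endo_eq_id x a.hom).trans (IsScwol.endo_eq_id x b.hom).symm)⟩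
  infer_instance

/-! ### Modules over a category -/

/-- `RΓ`-modules: contravariant functors from `Γ` to `R`-modules. -/
abbrev CatModule (R : Type w) [CommRing R] (Γ : Type u) [SmallCategory Γ] :=
  Γᵒᵖ ⥤ ModuleCat.{max u w} R

namespace CatModule

variable (R : Type w) [CommRing R] {Γ : Type u} [SmallCategory Γ]

variable (Γ) in
/-- The constant `RΓ`-module with value `R`. -/
def const : CatModule R Γ :=
  (Functor.const Γᵒᵖ).obj (ModuleCat.of R (ULift.{u} R))

/-- The free `RΓ`-module on an `ob(Γ)`-set `C`: the direct sum of the modules `R mor(?, x)`, taken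
over all `x` and all elements of `C x`. -/
def free (C : Γ → Type u) : CatModule R Γ where
  obj y := ModuleCat.of R ((Σ x : Γ, C x × (y.unop ⟶ x)) →₀ R)
  map f := ModuleCat.ofHom
    (Finsupp.lmapDomain R R fun p => ⟨p.1, p.2.1, f.unop ≫ p.2.2⟩)
  map_id y := by
    refine ModuleCat.hom_ext (Finsupp.lhom_ext fun p r => ?_)
    simp
  map_comp f g := by
    refine ModuleCat.hom_ext (Finsupp.lhom_ext fun p r => ?_)
    simp [Finsupp.mapDomain_single]

variable {R}

/-- `M` is finitely generated: a quotient of a free module on a finite `ob(Γ)`-set. -/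
def IsFG (M : CatModule R Γ) : Prop :=
  ∃ C : Γ → Type u, Finite (Σ x : Γ, C x) ∧
    ∃ f : free R C ⟶ M, ∀ y : Γᵒᵖ, Function.Surjective (f.app y)

/-- The submodule of `M(x)` generated by the images of all `M(u) : M(y) → M(x)`, for `u : x ⟶ y`
non-invertible. -/
def splitSubmodule (x : Γ) (M : CatModule R Γ) : Submodule R (M.obj (op x)) :=
  ⨆ (y : Γ) (u : x ⟶ y) (_ : ¬ IsIso u), LinearMap.range (M.map u.op).hom

theorem splitSubmodule_le (x : Γ) {M N : CatModule R Γ} (f : M ⟶ N) :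
    splitSubmodule x M ≤ (splitSubmodule x N).comap (f.app (op x)).hom := by
  refine iSup_le fun y => iSup_le fun v => iSup_le fun hv => ?_
  rintro _ ⟨m, rfl⟩
  have h1 : LinearMap.range (N.map v.op).hom ≤ splitSubmodule x N :=
    le_iSup_of_le y (le_iSup_of_le v (le_iSup_of_le hv le_rfl))
  refine h1 ⟨(f.app (op y)).hom m, ?_⟩
  have := f.naturality v.op
  exact (congrArg (fun k => k.hom m) this).symm

/-- The splitting functor `S_x`, sending `M` to the quotient of `M(x)` by `splitSubmodule x M`. -/
def splitting (x : Γ) : CatModule R Γ ⥤ ModuleCat.{max u w} R where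
  obj M := ModuleCat.of R (M.obj (op x) ⧸ splitSubmodule x M)
  map {M N} f := ModuleCat.ofHom
    ((splitSubmodule x M).mapQ (splitSubmodule x N) (f.app (op x)).hom (splitSubmodule_le x f))
  map_id M := by
    refine ModuleCat.hom_ext (LinearMap.ext fun m => ?_)
    obtain ⟨m, rfl⟩ := Submodule.Quotient.mk_surjective _ m
    rfl
  map_comp f g := by
    refine ModuleCat.hom_ext (LinearMap.ext fun m => ?_)
    obtain ⟨m, rfl⟩ := Submodule.Quotient.mk_surjective _ m
    rfl

instance (x : Γ) : (splitting (R := R) x).Additive where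
  map_add {M N f g} := by
    refine ModuleCat.hom_ext (LinearMap.ext fun m => ?_)
    obtain ⟨m, rfl⟩ := Submodule.Quotient.mk_surjective _ m
    rfl

/-- `S_x M ⊗_{R[x]} R`, where `R[x]` is the group ring of `Aut x` and `R` carries the trivial action:
the quotient of `S_x M` by all differences `m·u - m` with `u ∈ Aut x`. -/
def splittingTensor (x : Γ) (M : CatModule R Γ) : ModuleCat.{max u w} R :=
  ModuleCat.of R (((splitting x).obj M) ⧸ Submodule.span R
    {z : M.obj (op x) ⧸ splitSubmodule x M | ∃ (v : Aut x) (m : M.obj (op x)),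
      z = Submodule.Quotient.mk ((M.map v.hom.op).hom m) - Submodule.Quotient.mk m})

end CatModule

/-- The set `iso(Γ)` of isomorphism classes of objects. -/
abbrev IsoClasses (Γ : Type u) [SmallCategory Γ] : Type u := Quotient (isIsomorphicSetoid Γ)

/-! ### The Euler characteristic -/

/-- A notion of rank for finitely generated `R`-modules: integer valued, `rk R = 1`, and additive on
short exact sequences of finitely generated modules (values on other modules are irrelevant). -/
structure RankFunction (R : Type w) [CommRing R] where
  rk : ModuleCat.{max u w} R → ℤ
  rk_ring : rk (ModuleCat.of R (ULift.{u} R)) = 1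
  rk_additive : ∀ S : ShortComplex (ModuleCat.{max u w} R), S.ShortExact →
    Module.Finite R S.X₁ → Module.Finite R S.X₂ → Module.Finite R S.X₃ →
      rk S.X₂ = rk S.X₁ + rk S.X₃

section Euler

variable (R : Type w) [CommRing R] (Γ : Type u) [SmallCategory Γ]

variable {R Γ} in
/-- A projective resolution is finite if it has finite length and consists of finitely generated
modules. -/
def IsFiniteResolution (P : ProjectiveResolution (CatModule.const R Γ)) : Prop :=
  (∀ n, CatModule.IsFG (P.complex.X n)) ∧
    ∃ d : ℕ, ∀ n, d < n → Limits.IsZero (P.complex.X n)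

/-- `Γ` is of type (FP_R): the constant module `R` has a finite projective resolution. -/
def IsTypeFP : Prop :=
  ∃ P : ProjectiveResolution (CatModule.const R Γ), IsFiniteResolution P

variable {R Γ} in
/-- The component at an isomorphism class of the functorial Euler characteristic, computed from a
resolution. -/
def functorialEulerCharOf (rank : RankFunction.{u, w} R)
    (P : ProjectiveResolution (CatModule.const R Γ)) (c : IsoClasses Γ) : ℤ :=
  ∑ᶠ n : ℕ, (-1) ^ n * rank.rk (CatModule.splittingTensor c.out (P.complex.X n))

open Classical in
/-- The Euler characteristic `χ(Γ; R)` of a category of type (FP_R), computed from a finite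
projective resolution of the constant module. -/
def eulerChar (rank : RankFunction.{u, w} R) : ℤ :=
  if h : IsTypeFP R Γ then ∑ᶠ c : IsoClasses Γ, functorialEulerCharOf rank h.choose c else 0

end Euler

/-! ### The L²-Euler characteristic, for categories with finite automorphism groups

For a finite group `H` the group von Neumann algebra `𝒩(H)` is the group ring `ℂ[H]`, the functor
`- ⊗_{ℂ[H]} 𝒩(H)` is the identity and `dim_{𝒩(H)} M = dim_ℂ M / |H|`. -/

section L2

/-- The von Neumann dimension of a `ℂ[H]`-module with underlying vector space `V`, for a finite
group `H`. -/
def vonNeumannDim (H : Type*) [Group H] [Finite H] (V : ModuleCat.{u} ℂ) : ℝ≥0∞ :=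
  ((Module.rank ℂ V).toENat : ℝ≥0∞) / (Nat.card H : ℝ≥0∞)

variable (Γ : Type u) [SmallCategory Γ] [∀ x : Γ, Finite (Aut x)]

variable {Γ} in
/-- The von Neumann dimension of the `n`-th homology of `S_x P ⊗_{ℂ[x]} 𝒩(x)`. -/
def l2Betti (P : ProjectiveResolution (CatModule.const ℂ Γ)) (x : Γ) (n : ℕ) : ℝ≥0∞ :=
  vonNeumannDim (Aut x)
    ((((CatModule.splitting (R := ℂ) x).mapHomologicalComplex _).obj P.complex).homology n)

variable {Γ} in
/-- The finiteness condition of type (L²), for a given projective resolution. -/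
def IsL2Resolution (P : ProjectiveResolution (CatModule.const ℂ Γ)) : Prop :=
  ∑' (c : IsoClasses Γ) (n : ℕ), l2Betti P c.out n < ⊤

/-- `Γ` is of type (L²). The projective resolution need not be finite. -/
def IsTypeL2 : Prop :=
  ∃ P : ProjectiveResolution (CatModule.const ℂ Γ), IsL2Resolution P

variable {Γ} in
/-- The component at an isomorphism class of the functorial L²-Euler characteristic, computed from a
resolution. -/
def functorialL2EulerCharOf (P : ProjectiveResolution (CatModule.const ℂ Γ))
    (c : IsoClasses Γ) : ℝ :=
  ∑' n : ℕ, (-1) ^ n * (l2Betti P c.out n).toReal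

open Classical in
/-- The L²-Euler characteristic of a category of type (L²). -/
def l2EulerChar : ℝ :=
  if h : IsTypeL2 Γ then ∑' c : IsoClasses Γ, functorialL2EulerCharOf h.choose c else 0

end L2

end

/-!
A finite scwol `Γ` determines the square matrix, indexed by isomorphism classes of objects, whose
entry at `(c, d)` is the number of morphisms from `c` to `d`. Since endomorphisms are identities,
this matrix is unitriangular, so there is exactly one weighting of `Γ`: one integer for each class
such that the matrix sends the resulting vector to the vector of ones
(`IsScwol.eq_of_homCount_sum_eq`). Both Euler characteristics turn out to be the sum of the values
of the weighting, independently of `R` and of the rank, and the weighting behaves well under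
quotients.

Existence of finite resolutions: a module `M` that is free of finite rank at every object is covered
by the free module with one generator for each element of a basis of `M` at a chosen representative
of each isomorphism class. At each representative, the basis vectors of the cover given by
invertible morphisms map bijectively to the chosen basis, so the kernel is again free of finite
rank, with a basis indexed by the non-invertible morphisms. It lives at objects from which strictly
more objects can be reached, so the process ends (`CatModule.exists_isFiniteFreeResolution`).
Counting generators shows that the alternating sum of the numbers of generators in each class solves the
linear system given by the ranks of `M`; for the constant module this makes it the weighting.

Independence of the resolution: two resolutions are homotopy equivalent, hence so are their images
under the additive functor `S_x`. The mapping cone is a bounded exact complex of finitely generated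
modules, so additivity of the rank gives equality of the Euler characteristics
(`RankFunction.alternating_sum_eq_of_homotopyEquiv`). For the `L²`-version homotopy equivalent
complexes have isomorphic homology, and the Euler–Poincaré formula
`ChainComplex.sum_finrank_homology` leads back to counting generators.

Quotients: for a free action, morphisms of `X / G` lift uniquely once a lift of the source is given
(`ScwolAction.sigmaHomEquiv`), and `G` acts freely on the isomorphism classes of `X` with quotient
the isomorphism classes of `X / G` (`ScwolAction.isoClassesEquiv`), because an isomorphism between
two objects of one orbit would violate the definition of an action. Hence the weighting of `X / G`
pulls back to that of `X`, and its sum is multiplied by `|G|`.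
-/

universe v

noncomputable section

/-! ### Rank functions on finitely generated modules -/

namespace RankFunction

variable {R : Type w} [CommRing R] (rank : RankFunction.{u, w} R)

theorem rk_eq_add {M N P : Type (max u w)} [AddCommGroup M] [AddCommGroup N] [AddCommGroup P]
    [Module R M] [Module R N] [Module R P] [Module.Finite R M] [Module.Finite R N]
    [Module.Finite R P] (f : M →ₗ[R] N) (g : N →ₗ[R] P) (hf : Function.Injective f)
    (hg : Function.Surjective g) (hfg : Function.Exact f g) :
    rank.rk (ModuleCat.of R N) = rank.rk (ModuleCat.of R M) + rank.rk (ModuleCat.of R P) := by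
  let S : ShortComplex (ModuleCat.{max u w} R) :=
    ShortComplex.mk (ModuleCat.ofHom f) (ModuleCat.ofHom g)
      (ModuleCat.hom_ext (hfg.linearMap_comp_eq_zero))
  have hS : S.ShortExact :=
    { exact := (ShortComplex.ShortExact.moduleCat_exact_iff_function_exact S).2 hfg
      mono_f := (ModuleCat.mono_iff_injective _).2 hf
      epi_g := (ModuleCat.epi_iff_surjective _).2 hg }
  exact rank.rk_additive S hS ‹_› ‹_› ‹_›

theorem rk_of_subsingleton (M : Type (max u w)) [AddCommGroup M] [Module R M] [Subsingleton M] :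
    rank.rk (ModuleCat.of R M) = 0 := by
  have := rank.rk_eq_add (0 : M →ₗ[R] M) (0 : M →ₗ[R] M)
    (Function.injective_of_subsingleton _) (Function.surjective_to_subsingleton _)
    (fun y => by simp [Subsingleton.elim y 0])
  omega

theorem rk_congr {M N : Type (max u w)} [AddCommGroup M] [AddCommGroup N]
    [Module R M] [Module R N] [Module.Finite R M] (e : M ≃ₗ[R] N) :
    rank.rk (ModuleCat.of R M) = rank.rk (ModuleCat.of R N) := by
  have : Module.Finite R N := Module.Finite.equiv e
  have := rank.rk_eq_add e.toLinearMap (0 : N →ₗ[R] PUnit.{max u w + 1}) e.injective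
    (Function.surjective_to_subsingleton _)
    (fun y => ⟨fun _ => ⟨e.symm y, e.apply_symm_apply y⟩, fun _ => rfl⟩)
  rw [rank.rk_of_subsingleton PUnit] at this
  omega

theorem rk_prod (M N : Type (max u w)) [AddCommGroup M] [AddCommGroup N]
    [Module R M] [Module R N] [Module.Finite R M] [Module.Finite R N] :
    rank.rk (ModuleCat.of R (M × N)) = rank.rk (ModuleCat.of R M) + rank.rk (ModuleCat.of R N) :=
  rank.rk_eq_add (LinearMap.inl R M N) (LinearMap.snd R M N) LinearMap.inl_injective
    LinearMap.snd_surjective Function.Exact.inl_snd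

theorem rk_of_equiv_fin (n : ℕ) (M : Type (max u w)) [AddCommGroup M] [Module R M]
    (e : M ≃ₗ[R] (Fin n → R)) : rank.rk (ModuleCat.of R M) = n := by
  induction n generalizing M with
  | zero =>
    have : Subsingleton M := e.toEquiv.subsingleton
    simpa using rank.rk_of_subsingleton M
  | succ n ih =>
    have e' : M ≃ₗ[R] (ULift.{max u w} (Fin n → R)) × (ULift.{u} R) :=
      e ≪≫ₗ (Fin.consLinearEquiv R (fun _ : Fin (n + 1) => R)).symm ≪≫ₗ
        LinearEquiv.prodComm R _ _ ≪≫ₗ (ULift.moduleEquiv.symm.prodCongr ULift.moduleEquiv.symm)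
    have : Module.Finite R M := Module.Finite.equiv e.symm
    rw [rank.rk_congr e', rank.rk_prod, ih _ ULift.moduleEquiv, rank.rk_ring]
    simp

theorem rk_of_equiv_finsupp {α : Type*} [Finite α] {M : Type (max u w)} [AddCommGroup M]
    [Module R M] (e : M ≃ₗ[R] (α →₀ R)) : rank.rk (ModuleCat.of R M) = Nat.card α :=
  rank.rk_of_equiv_fin _ M (e ≪≫ₗ Finsupp.domLCongr (Finite.equivFin α) ≪≫ₗ
    Finsupp.linearEquivFunOnFinite R R (Fin (Nat.card α)))

/-- A bounded exact sequence `⋯ → M 1 → M 0 → 0` of finitely generated modules has vanishing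
alternating sum of ranks: every `M (n + 1)` is an extension of the image of `d n` by the image of
`d (n + 1)`, and these images are finitely generated, so the sum telescopes. -/
theorem alternating_sum_eq_zero (M : ℕ → ModuleCat.{max u w} R) [∀ n, Module.Finite R (M n)]
    (d : ∀ n, M (n + 1) →ₗ[R] M n) (h0 : Function.Surjective (d 0))
    (hd : ∀ n, Function.Exact (d (n + 1)) (d n)) (N : ℕ) [Subsingleton (M (N + 1))] :
    ∑ n ∈ Finset.range (N + 1), (-1) ^ n * rank.rk (M n) = 0 := by
  have key : ∀ n, ∑ i ∈ Finset.range (n + 1), (-1) ^ i * rank.rk (M i)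
      = (-1) ^ n * rank.rk (ModuleCat.of R (LinearMap.range (d n))) := by
    intro n
    induction n with
    | zero => simpa using (rank.rk_congr (LinearEquiv.ofTop _ (LinearMap.range_eq_top.2 h0))).symm
    | succ n ih =>
      have := rank.rk_eq_add (LinearMap.range (d (n + 1))).subtype (d n).rangeRestrict
        (Submodule.subtype_injective _) (d n).surjective_rangeRestrict (fun y => by
          rw [← ZeroMemClass.coe_eq_zero]
          change d n y = 0 ↔ _
          rw [hd n y]
          simp)
      rw [Finset.sum_range_succ, ih]
      change rank.rk (M (n + 1)) = _ at this
      rw [this]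
      ring
  rw [key]
  have : Subsingleton (LinearMap.range (d N)) :=
    (d N).surjective_rangeRestrict.subsingleton
  rw [rank.rk_of_subsingleton, mul_zero]

section Cone

variable {C D : ChainComplex (ModuleCat.{max u w} R) ℕ} (φ : C ⟶ D)

variable (C D) in
/-- The modules of the mapping cone of a map of chain complexes `C ⟶ D`, with `C` shifted up by
one degree. -/
def coneX : ℕ → ModuleCat.{max u w} R
  | 0 => D.X 0
  | n + 1 => ModuleCat.of R (C.X n × D.X (n + 1))

/-- The differential of the mapping cone, `(c, e) ↦ (-dc, φ c + de)`. -/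
def coneD : ∀ n, coneX C D (n + 1) →ₗ[R] coneX C D n
  | 0 => LinearMap.coprod (φ.f 0).hom (D.d 1 0).hom
  | n + 1 => LinearMap.prod (-(C.d (n + 1) n).hom ∘ₗ LinearMap.fst R _ _)
      (LinearMap.coprod (φ.f (n + 1)).hom (D.d (n + 2) (n + 1)).hom)

end Cone

end RankFunction

/-- Homotopy equivalent bounded complexes of finitely generated modules have the same Euler
characteristic, as the mapping cone is exact. -/
theorem RankFunction.alternating_sum_eq_of_homotopyEquiv {R : Type w} [CommRing R]
    (rank : RankFunction.{u, w} R) {C D : ChainComplex (ModuleCat.{max u w} R) ℕ}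
    (e : HomotopyEquiv C D) (hC : ∀ n, Module.Finite R (C.X n)) (hD : ∀ n, Module.Finite R (D.X n))
    (N : ℕ) (hCN : ∀ n, N ≤ n → Subsingleton (C.X n)) (hDN : ∀ n, N ≤ n → Subsingleton (D.X n)) :
    ∑ n ∈ Finset.range N, (-1) ^ n * rank.rk (C.X n) =
      ∑ n ∈ Finset.range N, (-1) ^ n * rank.rk (D.X n) := by
  have hfin : ∀ n, Module.Finite R (coneX C D n) := by
    rintro (_ | n)
    · exact hD 0
    · exact (inferInstance : Module.Finite R (C.X n × D.X (n + 1)))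
  have hsub : Subsingleton (coneX C D (N + 1)) := by
    have := hCN N le_rfl
    have := hDN (N + 1) (by omega)
    exact (inferInstance : Subsingleton (C.X N × D.X (N + 1)))
  have hφ : ∀ n c, e.hom.f n (C.d (n + 1) n c) = D.d (n + 1) n (e.hom.f (n + 1) c) := fun n c =>
    (congrArg (fun k => k.hom c) (e.hom.comm (n + 1) n)).symm
  have hψ : ∀ n c, e.inv.f n (D.d (n + 1) n c) = C.d (n + 1) n (e.inv.f (n + 1) c) := fun n c =>
    (congrArg (fun k => k.hom c) (e.inv.comm (n + 1) n)).symm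
  have hdC : ∀ n c, C.d (n + 1) n (C.d (n + 2) (n + 1) c) = 0 := fun n c =>
    congrArg (fun k => k.hom c) (C.d_comp_d (n + 2) (n + 1) n)
  have hdD : ∀ n c, D.d (n + 1) n (D.d (n + 2) (n + 1) c) = 0 := fun n c =>
    congrArg (fun k => k.hom c) (D.d_comp_d (n + 2) (n + 1) n)
  set H := e.homotopyHomInvId.hom
  set K := e.homotopyInvHomId.hom
  have hH0 : ∀ c, e.inv.f 0 (e.hom.f 0 c) = C.d 1 0 (H 0 1 c) + c := fun c => by
    have := e.homotopyHomInvId.comm 0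
    rw [Homotopy.dNext_zero_chainComplex, Homotopy.prevD_chainComplex, zero_add] at this
    exact congrArg (fun k => k.hom c) this
  have hH : ∀ n c, C.d (n + 1) n c = 0 → e.inv.f (n + 1) (e.hom.f (n + 1) c) =
      C.d (n + 2) (n + 1) (H (n + 1) (n + 2) c) + c := fun n c hc => by
    have := e.homotopyHomInvId.comm (n + 1)
    rw [Homotopy.dNext_succ_chainComplex, Homotopy.prevD_chainComplex] at this
    refine (congrArg (fun k => k.hom c) this).trans ?_
    change H n (n + 1) (C.d (n + 1) n c) + _ + c = _
    rw [hc, map_zero, zero_add]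
    rfl
  have hK0 : ∀ c, e.hom.f 0 (e.inv.f 0 c) = D.d 1 0 (K 0 1 c) + c := fun c => by
    have := e.homotopyInvHomId.comm 0
    rw [Homotopy.dNext_zero_chainComplex, Homotopy.prevD_chainComplex, zero_add] at this
    exact congrArg (fun k => k.hom c) this
  have hK : ∀ n c, D.d (n + 1) n c = 0 → e.hom.f (n + 1) (e.inv.f (n + 1) c) =
      D.d (n + 2) (n + 1) (K (n + 1) (n + 2) c) + c := fun n c hc => by
    have := e.homotopyInvHomId.comm (n + 1)
    rw [Homotopy.dNext_succ_chainComplex, Homotopy.prevD_chainComplex] at this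
    refine (congrArg (fun k => k.hom c) this).trans ?_
    change K n (n + 1) (D.d (n + 1) n c) + _ + c = _
    rw [hc, map_zero, zero_add]
    rfl
  -- Modify `(c, x)` by a boundary to make `c` vanish; then `x` is a cycle, hence homologous to
  -- the image of the cycle `e.inv x`.
  have lift : ∀ n (c : C.X n) (x : D.X (n + 1)),
      e.inv.f n (e.hom.f n c) = C.d (n + 1) n (H n (n + 1) c) + c →
      e.hom.f n c + D.d (n + 1) n x = 0 →
      ∃ (b : C.X (n + 1)) (y : D.X (n + 2)), -(C.d (n + 1) n b) = c ∧
        e.hom.f (n + 1) b + D.d (n + 2) (n + 1) y = x := by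
    intro n c x hc hx
    have hφc : e.hom.f n c = -(D.d (n + 1) n x) := eq_neg_of_add_eq_zero_left hx
    obtain ⟨b, hb⟩ : ∃ b, C.d (n + 1) n b = -c := by
      refine ⟨e.inv.f (n + 1) x + H n (n + 1) c, ?_⟩
      rw [hφc, map_neg, hψ] at hc
      rw [map_add, ← sub_eq_zero, sub_neg_eq_add, add_assoc, ← hc, add_neg_cancel]
    have hx' : D.d (n + 1) n (x - e.hom.f (n + 1) b) = 0 := by
      rw [map_sub, ← hφ, hb, map_neg, hφc]
      simp
    have hcyc : C.d (n + 1) n (e.inv.f (n + 1) (x - e.hom.f (n + 1) b)) = 0 := by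
      rw [← hψ, hx', map_zero]
    refine ⟨b + e.inv.f (n + 1) (x - e.hom.f (n + 1) b),
      -(K (n + 1) (n + 2) (x - e.hom.f (n + 1) b)), ?_, ?_⟩
    · rw [map_add, hb, hcyc, add_zero, neg_neg]
    · rw [map_add, hK n _ hx', map_neg]
      abel
  have surj : ∀ x : D.X 0, e.hom.f 0 (e.inv.f 0 x) + D.d 1 0 (-(K 0 1 x)) = x := fun x => by
    rw [hK0, map_neg]
    abel
  have hcone := rank.alternating_sum_eq_zero (coneX C D) (coneD e.hom)
    (fun x => ⟨((e.inv.f 0 x, -(K 0 1 x)) : C.X 0 × D.X 1), surj x⟩)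
    (by
      rintro (_ | n) ⟨c, x⟩
      · change e.hom.f 0 c + D.d 1 0 x = 0 ↔ _
        constructor
        · intro h
          obtain ⟨b, y, h1, h2⟩ := lift 0 c x (hH0 c) h
          exact ⟨((b, y) : C.X 1 × D.X 2), Prod.ext h1 h2⟩
        · rintro ⟨⟨b, y⟩, hby⟩
          obtain ⟨rfl, rfl⟩ := Prod.ext_iff.1 hby
          change e.hom.f 0 (-(C.d 1 0 b)) + D.d 1 0 (e.hom.f 1 b + D.d 2 1 y) = 0
          rw [map_neg, hφ, map_add, hdD]
          simp
      · constructor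
        · intro h
          obtain ⟨h1, h2⟩ := Prod.ext_iff.1 h
          obtain ⟨b, y, h1, h2⟩ := lift (n + 1) c x (hH n c (neg_eq_zero.1 h1)) h2
          exact ⟨((b, y) : C.X (n + 2) × D.X (n + 3)), Prod.ext h1 h2⟩
        · rintro ⟨⟨b, y⟩, hby⟩
          obtain ⟨rfl, rfl⟩ := Prod.ext_iff.1 hby
          refine Prod.ext ?_ ?_
          · change -(C.d (n + 1) n (-(C.d (n + 2) (n + 1) b))) = 0
            rw [map_neg, hdC, neg_zero, neg_zero]
          · change e.hom.f (n + 1) (-(C.d (n + 2) (n + 1) b)) + D.d (n + 2) (n + 1)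
              (e.hom.f (n + 2) b + D.d (n + 3) (n + 2) y) = 0
            rw [map_neg, hφ, map_add, hdD]
            simp) N
  have hcone_succ : ∀ n, rank.rk (coneX C D (n + 1)) = rank.rk (C.X n) + rank.rk (D.X (n + 1)) :=
    fun n => rank.rk_prod (C.X n) (D.X (n + 1))
  have hDN0 : rank.rk (D.X N) = 0 := by
    have := hDN N le_rfl
    exact rank.rk_of_subsingleton (D.X N)
  have hlast := Finset.sum_range_succ (fun n => (-1) ^ n * rank.rk (D.X n)) N
  rw [Finset.sum_range_succ'] at hcone hlast
  simp only [hcone_succ, hDN0, mul_add, Finset.sum_add_distrib, pow_succ, pow_zero, mul_zero,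
    add_zero, mul_neg, neg_mul, mul_one, Finset.sum_neg_distrib, one_mul] at hcone hlast
  change _ + rank.rk (D.X 0) = 0 at hcone
  linarith

/-! ### Splicing projective resolutions -/

/-- A projective resolution of the kernel of an epimorphism `f : F ⟶ M` with `F` projective becomes
a projective resolution of `M` on inserting `F` in degree `0`. -/
theorem CategoryTheory.ProjectiveResolution.exists_of_kernel {𝒜 : Type*} [Category.{v} 𝒜]
    [Abelian 𝒜] {F M : 𝒜} (f : F ⟶ M) [Epi f] [Projective F]
    (Q : ProjectiveResolution (Limits.kernel f)) :
    ∃ P : ProjectiveResolution M, P.complex.X 0 = F ∧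
      ∀ n, P.complex.X (n + 1) = Q.complex.X n := by
  have hw : Q.complex.d 1 0 ≫ Q.π.f 0 = 0 := Q.complex_d_comp_π_f_zero
  let ε : Q.complex.X 0 ⟶ Limits.kernel f := Q.π.f 0
  let K : ChainComplex 𝒜 ℕ := Q.complex.augment (ε ≫ Limits.kernel.ι f) (by
    rw [← Category.assoc]
    exact (congrArg (· ≫ Limits.kernel.ι f) hw).trans Limits.zero_comp)
  have hepi : Epi ε := inferInstanceAs (Epi (Q.π.f 0))
  have h0 : (ShortComplex.mk (ε ≫ Limits.kernel.ι f) f (by simp)).Exact := by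
    let φ : ShortComplex.mk (ε ≫ Limits.kernel.ι f) f (by simp) ⟶
        ShortComplex.mk (Limits.kernel.ι f) f (by simp) :=
      { τ₁ := ε, τ₂ := 𝟙 F, τ₃ := 𝟙 M }
    have : Epi φ.τ₁ := hepi
    have : IsIso φ.τ₂ := inferInstanceAs (IsIso (𝟙 F))
    have : Mono φ.τ₃ := inferInstanceAs (Mono (𝟙 M))
    exact (ShortComplex.exact_iff_of_epi_of_isIso_of_mono φ).2 (ShortComplex.exact_kernel f)
  have h1 : (ShortComplex.mk (Q.complex.d 1 0) (ε ≫ Limits.kernel.ι f)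
      (K.d_comp_d 2 1 0)).Exact := by
    let φ : ShortComplex.mk (Q.complex.d 1 0) ε hw ⟶
        ShortComplex.mk (Q.complex.d 1 0) (ε ≫ Limits.kernel.ι f) (K.d_comp_d 2 1 0) :=
      { τ₁ := 𝟙 (Q.complex.X 1), τ₂ := 𝟙 (Q.complex.X 0), τ₃ := Limits.kernel.ι f }
    have : Epi φ.τ₁ := inferInstanceAs (Epi (𝟙 _))
    have : IsIso φ.τ₂ := inferInstanceAs (IsIso (𝟙 _))
    have : Mono φ.τ₃ := inferInstanceAs (Mono (Limits.kernel.ι f))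
    exact (ShortComplex.exact_iff_of_epi_of_isIso_of_mono φ).1 Q.exact₀
  have hf : K.d 1 0 ≫ f = 0 := (Category.assoc ε (Limits.kernel.ι f) f).trans
    ((congrArg (ε ≫ ·) (Limits.kernel.condition f)).trans Limits.comp_zero)
  let π := (K.toSingle₀Equiv M).symm ⟨f, hf⟩
  have hπ : f = π.f 0 := (ChainComplex.toSingle₀Equiv_symm_apply_f_zero (V := 𝒜) (C := K) f hf).symm
  refine ⟨{ complex := K
            projective := ?_
            π := π
            quasiIso := ⟨?_⟩ }, rfl, fun n => rfl⟩
  · rintro (_ | n)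
    · assumption
    · exact Q.projective n
  · rintro (_ | _ | n)
    · rw [ChainComplex.quasiIsoAt₀_iff, ShortComplex.quasiIso_iff_of_zeros']
      · refine (ShortComplex.exact_and_epi_g_iff_of_iso ?_).2 ⟨h0, by assumption⟩
        exact ShortComplex.isoMk (Iso.refl _) (Iso.refl _) (Iso.refl _)
          ((Category.id_comp _).trans (Category.comp_id _).symm)
          ((Category.id_comp _).trans (hπ.trans (Category.comp_id _).symm))
      all_goals rfl
    · rw [quasiIsoAt_iff_exactAt']
      · rw [HomologicalComplex.exactAt_iff' K 2 1 0 (by simp) (by simp)]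
        exact h1
      · apply ChainComplex.exactAt_succ_single_obj
    · rw [quasiIsoAt_iff_exactAt']
      · rw [HomologicalComplex.exactAt_iff' K (n + 3) (n + 2) (n + 1) (by simp) (by simp)]
        exact Q.exact_succ n
      · apply ChainComplex.exactAt_succ_single_obj

/-! ### Kernels of maps out of free modules -/

namespace Finsupp

variable {R : Type*} [CommRing R] {A : Type*}

theorem ker_lsubtypeDomain_le (s : Set A) {S : Submodule R (A →₀ R)}
    (h : ∀ a, a ∉ s → single a 1 ∈ S) :
    LinearMap.ker (lsubtypeDomain s : (A →₀ R) →ₗ[R] (s →₀ R)) ≤ S := by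
  intro x hx
  rw [← x.sum_single]
  refine Submodule.sum_mem _ fun a ha => ?_
  rw [← mul_one (x a), ← smul_eq_mul, ← smul_single]
  refine S.smul_mem _ (h a fun has => (Finsupp.mem_support_iff.1 ha) ?_)
  exact DFunLike.congr_fun (LinearMap.mem_ker.1 hx) ⟨a, has⟩

theorem lsubtypeDomain_single_of_notMem {s : Set A} {a : A} (ha : a ∉ s) (r : R) :
    lsubtypeDomain (R := R) s (single a r) = 0 := by
  ext c
  change (single a r : A →₀ R) c = 0
  exact single_eq_of_ne fun h => ha (h ▸ c.2)

theorem lsubtypeDomain_single (s : Set A) (a : s) (r : R) :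
    lsubtypeDomain (R := R) s (single (a : A) r) = single a r := by
  classical
  ext c
  change (single (a : A) r : A →₀ R) c = _
  simp [single_apply, Subtype.ext_iff]

theorem lsubtypeDomain_surjective (s : Set A) :
    Function.Surjective (Finsupp.lsubtypeDomain s : (A →₀ R) →ₗ[R] (s →₀ R)) := fun y =>
  ⟨Finsupp.mapDomain Subtype.val y, by
    ext a
    exact Finsupp.mapDomain_apply Subtype.val_injective y a⟩

/-- If `f` maps the basis vectors in `s` bijectively onto a basis of the target, then the remaining
basis vectors index a basis of the kernel: each is corrected by a combination of vectors in `s`. -/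
theorem exists_basis_ker {M β : Type*} [AddCommGroup M] [Module R M] (b : Module.Basis β R M)
    (s : Set A) (e : β ≃ s) (f : (A →₀ R) →ₗ[R] M) (hf : ∀ i, f (single (e i : A) 1) = b i) :
    Nonempty (Module.Basis (sᶜ : Set A) R (LinearMap.ker f)) := by
  -- `g` is the section of `f` with image the span of `s`; `res` and `ext` are restriction to and
  -- extension by zero from the complement of `s`
  obtain ⟨g, hg⟩ : ∃ g : M →ₗ[R] (A →₀ R), ∀ i, g (b i) = single (e i : A) 1 :=
    ⟨b.constr R fun i => single (e i : A) 1, fun i => b.constr_basis R _ i⟩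
  have hfg : ∀ m, f (g m) = m := DFunLike.congr_fun
    (b.ext (f₁ := f ∘ₗ g) (f₂ := LinearMap.id) fun i => by simp [hg, hf])
  obtain ⟨res, hres₀, hres₁⟩ : ∃ res : (A →₀ R) →ₗ[R] ((sᶜ : Set A) →₀ R),
      (∀ a ∈ s, res (single a 1) = 0) ∧ ∀ a : (sᶜ : Set A), res (single a 1) = single a 1 :=
    ⟨lsubtypeDomain sᶜ, fun a ha => lsubtypeDomain_single_of_notMem (Set.notMem_compl_iff.2 ha) 1,
      fun a => lsubtypeDomain_single sᶜ a 1⟩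
  obtain ⟨ext, hext⟩ : ∃ ext : ((sᶜ : Set A) →₀ R) →ₗ[R] (A →₀ R),
      ∀ a : (sᶜ : Set A), ext (single a 1) = single (a : A) 1 :=
    ⟨lmapDomain R R Subtype.val, fun a => mapDomain_single⟩
  have hre : ∀ y, res (ext y) = y := DFunLike.congr_fun
    (Finsupp.lhom_ext' (φ := res ∘ₗ ext) (ψ := LinearMap.id) fun a => LinearMap.ext_ring
      (by simp [hext, hres₁]))
  have hrg : ∀ m, res (g m) = 0 := DFunLike.congr_fun
    (b.ext (f₁ := res ∘ₗ g) (f₂ := 0) fun i => by simp [hg, hres₀])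
  have key : ∀ x, g (f (x - ext (res x))) = x - ext (res x) := by
    suffices h : g ∘ₗ f ∘ₗ (LinearMap.id - ext ∘ₗ res) = LinearMap.id - ext ∘ₗ res from
      fun x => DFunLike.congr_fun h x
    refine Finsupp.lhom_ext' fun a => LinearMap.ext_ring ?_
    change g (f (single a 1 - ext (res (single a 1)))) = single a 1 - ext (res (single a 1))
    by_cases ha : a ∈ s
    · obtain ⟨i, hi⟩ := e.surjective ⟨a, ha⟩
      obtain rfl : (e i : A) = a := congrArg Subtype.val hi
      have hr : res (single (e i : A) 1) = 0 := hres₀ _ ha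
      rw [hr, map_zero, sub_zero, hf, hg]
    · have hr : ext (res (single a 1)) = single a 1 :=
        (congrArg ext (hres₁ ⟨a, ha⟩)).trans (hext ⟨a, ha⟩)
      rw [hr, sub_self, map_zero, map_zero]
  refine ⟨⟨LinearEquiv.ofBijective (res ∘ₗ (LinearMap.ker f).subtype) ⟨?_, ?_⟩⟩⟩
  · have hrec : ∀ x : LinearMap.ker f, (x : A →₀ R) = ext (res x) - g (f (ext (res x))) := by
      rintro ⟨x, hx⟩
      have := key x
      rw [map_sub f, LinearMap.mem_ker.1 hx, zero_sub, map_neg] at this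
      change x = ext (res x) - g (f (ext (res x)))
      rw [sub_eq_add_neg, this, add_sub_cancel]
    intro x y hxy
    have hxy : res x = res y := hxy
    exact Subtype.ext (by rw [hrec x, hrec y, hxy])
  · intro y
    refine ⟨⟨ext y - g (f (ext y)), by simp [hfg]⟩, ?_⟩
    change res (ext y - g (f (ext y))) = y
    rw [map_sub, hre, hrg, sub_zero]

end Finsupp

/-! ### Free modules over a category -/

namespace CatModule

variable {R : Type w} [CommRing R] {Γ : Type u} [SmallCategory Γ]

/-- The map out of a free module determined by the images of the generators. -/
def freeDesc {C : Γ → Type u} {M : CatModule R Γ} (φ : ∀ x, C x → M.obj (op x)) :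
    free R C ⟶ M where
  app y := ModuleCat.ofHom (Finsupp.linearCombination R
    fun p : Σ x : Γ, C x × (y.unop ⟶ x) => (M.map p.2.2.op).hom (φ p.1 p.2.1))
  naturality y z f := by
    refine ModuleCat.hom_ext (Finsupp.lhom_ext fun p r => ?_)
    change Finsupp.linearCombination R _ (Finsupp.mapDomain _ (Finsupp.single p r)) =
      (M.map f).hom (Finsupp.linearCombination R _ (Finsupp.single p r))
    simp [Finsupp.mapDomain_single]

theorem freeDesc_single {C : Γ → Type u} {M : CatModule R Γ} (φ : ∀ x, C x → M.obj (op x))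
    {y : Γ} (p : Σ x : Γ, C x × (y ⟶ x)) :
    ((freeDesc φ).app (op y)).hom (Finsupp.single p 1) = (M.map p.2.2.op).hom (φ p.1 p.2.1) := by
  refine (Finsupp.linearCombination_single ..).trans ?_
  rw [one_smul]

theorem free_hom_ext {C : Γ → Type u} {M : CatModule R Γ} {f g : free R C ⟶ M}
    (h : ∀ x (c : C x), (f.app (op x)).hom (Finsupp.single ⟨x, c, 𝟙 x⟩ 1) =
      (g.app (op x)).hom (Finsupp.single ⟨x, c, 𝟙 x⟩ 1)) : f = g := by
  ext y : 2
  refine ModuleCat.hom_ext (Finsupp.lhom_ext' fun p => LinearMap.ext_ring ?_)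
  obtain ⟨x, c, v⟩ := p
  have hs : (Finsupp.single ⟨x, c, v⟩ 1 : (Σ x : Γ, C x × (y.unop ⟶ x)) →₀ R) =
      ((free R C).map v.op).hom (Finsupp.single ⟨x, c, 𝟙 x⟩ 1) := by
    refine Eq.trans ?_ (Finsupp.mapDomain_single ..).symm
    simp
  have hf := congrArg (fun k => k.hom (Finsupp.single ⟨x, c, 𝟙 x⟩ 1)) (f.naturality v.op)
  have hg := congrArg (fun k => k.hom (Finsupp.single ⟨x, c, 𝟙 x⟩ 1)) (g.naturality v.op)
  change (f.app y).hom (Finsupp.single ⟨x, c, v⟩ 1) = (g.app y).hom (Finsupp.single ⟨x, c, v⟩ 1)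
  rw [hs]
  exact (hf.trans (congrArg (M.map v.op).hom (h x c))).trans hg.symm

instance projective_free (C : Γ → Type u) : Projective (free R C) where
  factors {E M} f e _ := by
    have he : ∀ y, Function.Surjective (e.app y).hom := fun _ =>
      (ModuleCat.epi_iff_surjective _).1 inferInstance
    choose s hs using he
    refine ⟨freeDesc fun x c => s (op x) ((f.app (op x)).hom (Finsupp.single ⟨x, c, 𝟙 x⟩ 1)),
      free_hom_ext fun x c => ?_⟩
    change (e.app (op x)).hom (((freeDesc _).app (op x)).hom _) = _
    rw [freeDesc_single]
    simp [hs]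

theorem isFG_of_iso_free {M : CatModule R Γ} {C : Γ → Type u} (hC : Finite (Σ x, C x))
    (e : M ≅ free R C) : IsFG M :=
  ⟨C, hC, e.inv, fun _ => (ModuleCat.epi_iff_surjective _).1 inferInstance⟩

theorem finite_freeIndex [∀ x y : Γ, Finite (x ⟶ y)] {C : Γ → Type u} (hC : Finite (Σ x, C x))
    (y : Γ) : Finite (Σ x : Γ, C x × (y ⟶ x)) :=
  Finite.of_injective (β := Σ p : Σ x, C x, (y ⟶ p.1))
    (fun p => ⟨⟨p.1, p.2.1⟩, p.2.2⟩) (by rintro ⟨x, c, v⟩ ⟨x', c', v'⟩ h; cases h; rfl)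

theorem finite_obj_of_isFG [∀ x y : Γ, Finite (x ⟶ y)] {M : CatModule R Γ} (hM : IsFG M)
    (y : Γᵒᵖ) : Module.Finite R (M.obj y) := by
  obtain ⟨C, hC, f, hf⟩ := hM
  have := finite_freeIndex hC y.unop
  have : Module.Finite R ((free R C).obj y) :=
    inferInstanceAs (Module.Finite R ((Σ x : Γ, C x × (y.unop ⟶ x)) →₀ R))
  exact Module.Finite.of_surjective _ (hf y)

theorem finite_splitting_of_isFG [∀ x y : Γ, Finite (x ⟶ y)] {M : CatModule R Γ} (hM : IsFG M)
    (x : Γ) : Module.Finite R ((splitting x).obj M) := by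
  have := finite_obj_of_isFG hM (op x)
  exact inferInstanceAs (Module.Finite R (M.obj (op x) ⧸ splitSubmodule x M))

/-- The generators of `free R C` at `x` that survive in `S_x (free R C)`: generators living at
objects `y ≅ x`, transported along an isomorphism. -/
abbrev isoGenerators (x : Γ) (C : Γ → Type u) : Set (Σ y : Γ, C y × (x ⟶ y)) :=
  {p | IsIso p.2.2}

end CatModule

/-- Two objects of a scwol with morphisms in both directions are isomorphic. -/
theorem IsScwol.isIso_of_comp {X : Type*} [Category X] [IsScwol X] {x y : X} (u : x ⟶ y)
    (v : y ⟶ x) : IsIso u :=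
  ⟨v, IsScwol.endo_eq_id _ _, IsScwol.endo_eq_id _ _⟩

namespace CatModule
variable {R : Type w} [CommRing R] {Γ : Type u} [SmallCategory Γ] [IsScwol Γ]

/-- The projection of a free module, evaluated at `x`, to the span of the generators that survive
in `S_x`. -/
def isoProj (x : Γ) (C : Γ → Type u) :
    (free R C).obj (op x) →ₗ[R] (isoGenerators x C →₀ R) :=
  Finsupp.lsubtypeDomain (isoGenerators x C)

theorem splitSubmodule_free (x : Γ) (C : Γ → Type u) :
    splitSubmodule x (free R C) = LinearMap.ker (isoProj x C) := by
  apply le_antisymm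
  · refine iSup_le fun z => iSup_le fun v => iSup_le fun hv => ?_
    refine LinearMap.range_le_ker_iff.2 (Finsupp.lhom_ext (M := R) fun p r => ?_)
    refine (congrArg (isoProj x C) (Finsupp.mapDomain_single ..)).trans ?_
    refine Finsupp.lsubtypeDomain_single_of_notMem (R := R) (s := isoGenerators x C)
      (fun h => hv ?_) r
    have h : IsIso (v ≫ p.2.2) := h
    exact IsScwol.isIso_of_comp v (p.2.2 ≫ inv (v ≫ p.2.2))
  · refine Finsupp.ker_lsubtypeDomain_le (R := R) (isoGenerators x C)
      (S := splitSubmodule x (free R C)) ?_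
    rintro ⟨y, c, t⟩ ht
    refine (le_iSup_of_le y (le_iSup_of_le t (le_iSup_of_le ht le_rfl)) :
      LinearMap.range ((free R C).map t.op).hom ≤ splitSubmodule x (free R C))
      ⟨Finsupp.single ⟨y, c, 𝟙 y⟩ 1, ?_⟩
    refine (Finsupp.mapDomain_single ..).trans ?_
    simp

/-- Over a scwol, `S_x` of a free module is free on the generators that survive at `x`. -/
def splittingFreeEquiv (x : Γ) (C : Γ → Type u) :
    ((splitting x).obj (free R C)) ≃ₗ[R] (isoGenerators x C →₀ R) :=
  (Submodule.quotEquivOfEq _ _ (splitSubmodule_free x C)).trans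
    ((isoProj (R := R) x C).quotKerEquivOfSurjective
      (Finsupp.lsubtypeDomain_surjective (isoGenerators x C)))

/-- Automorphism groups of a scwol are trivial, so that taking coinvariants does not change
`S_x M`. -/
def splittingTensorEquiv (x : Γ) (M : CatModule R Γ) :
    splittingTensor x M ≃ₗ[R] (splitting x).obj M :=
  have h : Submodule.span R {z : M.obj (op x) ⧸ splitSubmodule x M |
      ∃ (v : Aut x) (m : M.obj (op x)), z = Submodule.Quotient.mk ((M.map v.hom.op).hom m) -
        Submodule.Quotient.mk m} = ⊥ := by
    rw [Submodule.span_eq_bot]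
    rintro _ ⟨v, m, rfl⟩
    rw [IsScwol.endo_eq_id x v.hom]
    simp
  Submodule.quotEquivOfEqBot _ h

end CatModule

/-! ### Weightings of a finite scwol -/

namespace IsScwol

variable {Γ : Type u} [SmallCategory Γ]

/-- The number of objects that receive a morphism from `x`. -/
def height (x : Γ) : ℕ := Nat.card {z : Γ // Nonempty (x ⟶ z)}

theorem height_pos [Finite Γ] (x : Γ) : 0 < height x :=
  have : Nonempty {z : Γ // Nonempty (x ⟶ z)} := ⟨⟨x, ⟨𝟙 x⟩⟩⟩
  Nat.card_pos

theorem height_le [Finite Γ] (x : Γ) : height x ≤ Nat.card Γ :=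
  Nat.card_le_card_of_injective _ Subtype.val_injective

theorem height_lt [IsScwol Γ] [Finite Γ] {x y : Γ} (u : x ⟶ y) (hu : ¬ IsIso u) :
    height y < height x := by
  have h : {z : Γ | Nonempty (y ⟶ z)} ⊂ {z : Γ | Nonempty (x ⟶ z)} := by
    refine (Set.ssubset_iff_of_subset fun z (h : Nonempty (y ⟶ z)) => h.map (u ≫ ·)).2 ?_
    exact ⟨x, ⟨𝟙 x⟩, fun ⟨v⟩ => hu (isIso_of_comp u v)⟩
  exact Set.ncard_lt_ncard h (Set.toFinite _)

/-- The number of morphisms between two isomorphism classes. -/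
def homCount (c d : IsoClasses Γ) : ℤ := Nat.card (c.out ⟶ d.out)

theorem eq_of_isIso {c d : IsoClasses Γ} (u : c.out ⟶ d.out) (hu : IsIso u) : c = d := by
  rw [← c.out_eq, ← d.out_eq]
  exact Quotient.sound ⟨asIso u⟩

theorem homCount_self [IsScwol Γ] (c : IsoClasses Γ) : homCount c c = 1 := by
  have : Unique (c.out ⟶ c.out) := ⟨⟨𝟙 _⟩, fun f => endo_eq_id _ f⟩
  simp [homCount]

/-- The matrix `homCount` is unitriangular for the order by height, hence injective. -/
theorem eq_of_homCount_sum_eq [IsScwol Γ] [Finite Γ] [Fintype (IsoClasses Γ)]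
    {v w : IsoClasses Γ → ℤ}
    (h : ∀ c, ∑ d, homCount c d * v d = ∑ d, homCount c d * w d) : v = w := by
  funext c
  induction hn : height c.out using Nat.strong_induction_on generalizing c with
  | _ n ih =>
    have hc := h c
    classical
    rw [← Finset.add_sum_erase _ _ (Finset.mem_univ c),
      ← Finset.add_sum_erase _ (fun d => homCount c d * w d) (Finset.mem_univ c),
      homCount_self, one_mul, one_mul] at hc
    have hsum : ∑ d ∈ Finset.univ.erase c, homCount c d * v d =
        ∑ d ∈ Finset.univ.erase c, homCount c d * w d := by
      refine Finset.sum_congr rfl fun d hd => ?_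
      rcases isEmpty_or_nonempty (c.out ⟶ d.out) with h0 | ⟨⟨u⟩⟩
      · simp [homCount]
      · have hu : ¬ IsIso u := fun hu => Finset.ne_of_mem_erase hd (eq_of_isIso u hu).symm
        rw [ih _ (hn ▸ height_lt u hu) d rfl]
    linarith

/-- A weighting of a category: an integer for each isomorphism class of objects such that the
values at the targets of the morphisms out of any given object (one target per isomorphism class)
add up to `1`. -/
def IsWeighting [Fintype (IsoClasses Γ)] (w : IsoClasses Γ → ℤ) : Prop :=
  ∀ c, ∑ d, homCount c d * w d = 1

end IsScwol

/-! ### Finite free resolutions over a finite scwol -/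

namespace CatModule

variable {R : Type w} [CommRing R] {Γ : Type u} [SmallCategory Γ]

/-- The family of generating sets that has the elements of `B c` as generators at the chosen
representative of each isomorphism class `c`, and no other generators. -/
def repGenerators (B : IsoClasses Γ → Type u) (y : Γ) : Type u :=
  {p : Σ c, B c // p.1.out = y}

/-- The generator of index `i : B c`. -/
abbrev repGen {B : IsoClasses Γ → Type u} {c : IsoClasses Γ} (i : B c) :
    repGenerators B c.out := ⟨⟨c, i⟩, rfl⟩

/-- The basis vectors of `free R (repGenerators B)` at `x`. -/
def repGeneratorsEquiv (B : IsoClasses Γ → Type u) (x : Γ) :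
    (Σ y, repGenerators B y × (x ⟶ y)) ≃ Σ d, B d × (x ⟶ d.out) where
  toFun | ⟨_, ⟨⟨d, i⟩, rfl⟩, u⟩ => ⟨d, i, u⟩
  invFun p := ⟨p.1.out, repGen p.2.1, p.2.2⟩
  left_inv := by rintro ⟨_, ⟨⟨d, i⟩, rfl⟩, u⟩; rfl
  right_inv _ := rfl

theorem finite_repGenerators [Finite Γ] (B : IsoClasses Γ → Type u) [∀ c, Finite (B c)] :
    Finite (Σ y, repGenerators B y) :=
  Finite.of_injective (β := Σ c, B c) (fun p => p.2.1) (by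
    rintro ⟨_, ⟨p, rfl⟩⟩ ⟨_, ⟨q, rfl⟩⟩ h
    cases (show p = q from h)
    rfl)

/-- At a chosen representative `c.out`, the generators surviving in the splitting are those
indexed by `B c`. -/
def isoGeneratorsRepEquiv [IsScwol Γ] (B : IsoClasses Γ → Type u) (c : IsoClasses Γ) :
    B c ≃ isoGenerators c.out (repGenerators B) :=
  Equiv.ofBijective (fun i => ⟨⟨c.out, repGen i, 𝟙 _⟩, inferInstanceAs (IsIso (𝟙 _))⟩) <| by
    constructor
    · intro i j h
      have h := congrArg (fun p => repGeneratorsEquiv B c.out p.1) h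
      simpa [repGeneratorsEquiv] using h
    · rintro ⟨⟨_, ⟨⟨d, i⟩, rfl⟩, v⟩, hv : IsIso v⟩
      obtain rfl := IsScwol.eq_of_isIso v hv
      obtain rfl : v = 𝟙 c.out := IsScwol.endo_eq_id _ v
      exact ⟨i, rfl⟩

theorem card_isoGenerators_rep [IsScwol Γ] (B : IsoClasses Γ → Type u) (c : IsoClasses Γ) :
    Nat.card (isoGenerators c.out (repGenerators B)) = Nat.card (B c) :=
  Nat.card_congr (isoGeneratorsRepEquiv B c).symm

theorem card_compl_isoGenerators_rep [IsScwol Γ] [Finite Γ] [∀ x y : Γ, Finite (x ⟶ y)]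
    [Fintype (IsoClasses Γ)] (B : IsoClasses Γ → Type u) [∀ c, Finite (B c)] (c : IsoClasses Γ) :
    (Nat.card ((isoGenerators c.out (repGenerators B))ᶜ : Set _) : ℤ) =
      ∑ d, IsScwol.homCount c d * Nat.card (B d) - Nat.card (B c) := by
  classical
  have : Finite (Σ y, repGenerators B y × (c.out ⟶ y)) :=
    Finite.of_equiv _ (repGeneratorsEquiv B c.out).symm
  have h1 := Nat.card_congr (Equiv.Set.sumCompl (isoGenerators c.out (repGenerators B)))
  rw [Nat.card_sum, card_isoGenerators_rep, Nat.card_congr (repGeneratorsEquiv B c.out),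
    Nat.card_sigma] at h1
  rw [eq_sub_iff_add_eq, add_comm]
  refine (Nat.cast_add _ _).symm.trans ((congrArg Nat.cast h1).trans ?_)
  simp [Nat.card_prod, IsScwol.homCount, mul_comm]

/-- The map from a free module that hits given bases of `M` at the chosen representatives. -/
def repCover {M : CatModule R Γ} {B : IsoClasses Γ → Type u}
    (b : ∀ c, Module.Basis (B c) R (M.obj (op c.out))) : free R (repGenerators B) ⟶ M :=
  freeDesc fun
    | _, ⟨⟨c, i⟩, rfl⟩ => b c i

theorem repCover_single {M : CatModule R Γ} {B : IsoClasses Γ → Type u}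
    (b : ∀ c, Module.Basis (B c) R (M.obj (op c.out))) (c : IsoClasses Γ) (i : B c) :
    ((repCover b).app (op c.out)).hom (Finsupp.single ⟨c.out, repGen i, 𝟙 _⟩ 1) = b c i := by
  refine (freeDesc_single _ _).trans ?_
  simp [repGen]

theorem map_hom_map_inv {M : CatModule R Γ} {x y : Γ} (e : x ≅ y) (m : M.obj (op x)) :
    (M.map e.hom.op).hom ((M.map e.inv.op).hom m) = m := by
  rw [← LinearMap.comp_apply, ← ModuleCat.hom_comp, ← M.map_comp, ← op_comp, e.hom_inv_id]
  simp

/-- Every object is isomorphic to the chosen representative of its class. -/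
theorem nonempty_iso_out (y : Γ) :
    Nonempty (y ≅ (Quotient.mk (isIsomorphicSetoid Γ) y).out) :=
  (isIsomorphicSetoid Γ).symm (Quotient.mk_out (s := isIsomorphicSetoid Γ) y)

instance epi_repCover {M : CatModule R Γ} {B : IsoClasses Γ → Type u}
    (b : ∀ c, Module.Basis (B c) R (M.obj (op c.out))) : Epi (repCover b) := by
  have : ∀ y, Epi ((repCover b).app y) := fun y => by
    rw [ModuleCat.epi_iff_surjective]
    have hrep : ∀ c : IsoClasses Γ, Function.Surjective ((repCover b).app (op c.out)).hom := by
      intro c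
      rw [← LinearMap.range_eq_top, eq_top_iff, ← (b c).span_eq, Submodule.span_le]
      rintro _ ⟨i, rfl⟩
      exact ⟨_, repCover_single b c i⟩
    intro m
    obtain ⟨e⟩ := nonempty_iso_out y.unop
    obtain ⟨a, ha⟩ := hrep _ ((M.map e.inv.op).hom m)
    refine ⟨((free R _).map e.hom.op).hom a, ?_⟩
    have hnat := congrArg (fun k => k.hom a) ((repCover b).naturality e.hom.op)
    refine hnat.trans ((congrArg (M.map e.hom.op).hom ha).trans (map_hom_map_inv e m))
  exact NatTrans.epi_of_epi_app _

/-- The kernel of `repCover b` is again free at each representative, on the basis vectors given by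
non-invertible morphisms. -/
theorem exists_basis_kernel_repCover [IsScwol Γ] {M : CatModule R Γ} {B : IsoClasses Γ → Type u}
    (b : ∀ c, Module.Basis (B c) R (M.obj (op c.out))) (c : IsoClasses Γ) :
    Nonempty (Module.Basis ((isoGenerators c.out (repGenerators B))ᶜ : Set _) R
      ((Limits.kernel (repCover b)).obj (op c.out))) := by
  obtain ⟨b'⟩ := Finsupp.exists_basis_ker (b c) (isoGenerators c.out (repGenerators B))
    (isoGeneratorsRepEquiv B c) ((repCover b).app (op c.out)).hom (repCover_single b c)
  let E : (Limits.kernel (repCover b)).obj (op c.out) ≅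
      ModuleCat.of R (LinearMap.ker ((repCover b).app (op c.out)).hom) :=
    Limits.PreservesKernel.iso ((evaluation _ _).obj (op c.out)) (repCover b) ≪≫
      ModuleCat.kernelIsoKer _
  exact ⟨b'.map E.symm.toLinearEquiv⟩

theorem isZero_of_subsingleton {M : CatModule R Γ}
    (h : ∀ c : IsoClasses Γ, Subsingleton (M.obj (op c.out))) : Limits.IsZero M := by
  refine (Functor.isZero_iff M).2 fun y => ?_
  obtain ⟨e⟩ := nonempty_iso_out y.unop
  have := h (Quotient.mk (isIsomorphicSetoid Γ) y.unop)
  have : Subsingleton (M.obj y) :=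
    ⟨fun m m' => by
      rw [← map_hom_map_inv e m, ← map_hom_map_inv e m']
      exact congrArg _ (Subsingleton.elim _ _)⟩
  exact ModuleCat.isZero_of_subsingleton _

/-- `P` is a resolution by free modules on finite sets, vanishing from degree `N` on, with `a n c`
of the generators of the `n`-th module living in the isomorphism class `c`. -/
def IsFiniteFreeResolution {M : CatModule R Γ} (P : ProjectiveResolution M)
    (a : ℕ → IsoClasses Γ → ℕ) (N : ℕ) : Prop :=
  (∀ n, ∃ C : Γ → Type u, Finite (Σ x, C x) ∧ Nonempty (P.complex.X n ≅ free R C) ∧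
    ∀ c : IsoClasses Γ, Nat.card (isoGenerators c.out C) = a n c) ∧
  ∀ n, N ≤ n → Limits.IsZero (P.complex.X n)

/-- A module with finite bases at all representatives has a finite free resolution, whose Euler
characteristic is a solution of a linear system that does not involve `R`. The kernel of the cover
`repCover` lives at objects of larger height than the module itself, whence the induction. -/
theorem exists_isFiniteFreeResolution [IsScwol Γ] [Finite Γ] [∀ x y : Γ, Finite (x ⟶ y)]
    [Fintype (IsoClasses Γ)] (k : ℕ) (M : CatModule R Γ) (B : IsoClasses Γ → Type u)
    [∀ c, Finite (B c)] (b : ∀ c, Module.Basis (B c) R (M.obj (op c.out)))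
    (hB : ∀ c : IsoClasses Γ, IsScwol.height c.out + k ≤ Nat.card Γ → IsEmpty (B c)) :
    ∃ (P : ProjectiveResolution M) (a : ℕ → IsoClasses Γ → ℕ) (N : ℕ),
      IsFiniteFreeResolution P a N ∧
      ∀ c, ∑ d, IsScwol.homCount c d * ∑ n ∈ Finset.range N, (-1) ^ n * (a n d : ℤ) =
        Nat.card (B c) := by
  induction k generalizing M B with
  | zero =>
    have hB : ∀ c, IsEmpty (B c) := fun c => hB c (IsScwol.height_le _)
    have hM : Limits.IsZero M := isZero_of_subsingleton fun c =>
      (b c).repr.toEquiv.subsingleton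
    have : Projective M := hM.projective
    have hP : ∀ n, Limits.IsZero ((ProjectiveResolution.self M).complex.X n) := fun n =>
      (HomologicalComplex.eval _ _ n).map_isZero ((ChainComplex.single₀ _).map_isZero hM)
    refine ⟨ProjectiveResolution.self M, fun _ _ => 0, 0, ⟨fun n => ?_, fun n _ => hP n⟩, ?_⟩
    · have hE : ∀ x : Γ, IsEmpty (Σ y : Γ, PEmpty.{u + 1} × (x ⟶ y)) := fun x =>
        ⟨fun p => p.2.1.elim⟩
      have hF : Limits.IsZero (free R (fun _ : Γ => PEmpty.{u + 1})) :=
        isZero_of_subsingleton fun c =>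
        inferInstanceAs (Subsingleton ((Σ y : Γ, PEmpty.{u + 1} × (c.out ⟶ y)) →₀ R))
      refine ⟨fun _ => PEmpty, inferInstance, ⟨(hP n).iso hF⟩, fun c => ?_⟩
      have := hE c.out
      exact Nat.card_of_isEmpty
    · intro c
      simp
  | succ k ih =>
    have b' := fun c => (exists_basis_kernel_repCover b c).some
    have hfin : ∀ c : IsoClasses Γ, Finite ((isoGenerators c.out (repGenerators B))ᶜ : Set _) := by
      intro c
      have : Finite (Σ y, repGenerators B y × (c.out ⟶ y)) :=
        Finite.of_equiv _ (repGeneratorsEquiv B c.out).symm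
      infer_instance
    -- a basis vector of the kernel at `c.out` comes from a non-invertible morphism to an object at
    -- which `M` does not vanish, and this object has smaller height
    obtain ⟨Q, a, N, ⟨hQ, hQN⟩, hsum⟩ := ih (Limits.kernel (repCover b)) _
      (fun c => (b' c)) (fun c hc => ⟨by
        rintro ⟨⟨_, ⟨⟨d, i⟩, rfl⟩, v⟩, hv⟩
        have : IsScwol.height d.out < IsScwol.height c.out := IsScwol.height_lt v hv
        exact (hB d (by omega)).false i⟩)
    obtain ⟨P, hP0, hPs⟩ := ProjectiveResolution.exists_of_kernel (repCover b) Q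
    refine ⟨P, fun n => n.casesOn (fun c => Nat.card (B c)) a, N + 1, ⟨?_, ?_⟩, fun c => ?_⟩
    · rintro (_ | n)
      · exact ⟨_, finite_repGenerators B, ⟨eqToIso hP0⟩, card_isoGenerators_rep B⟩
      · obtain ⟨C, hC, ⟨e⟩, ha⟩ := hQ n
        exact ⟨C, hC, ⟨eqToIso (hPs n) ≪≫ e⟩, ha⟩
    · rintro (_ | n) hn
      · omega
      · rw [hPs]
        exact hQN n (by omega)
    · have hc := hsum c
      rw [card_compl_isoGenerators_rep] at hc
      simp only [Finset.sum_range_succ', pow_succ, mul_neg, mul_one, neg_mul,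
        Finset.sum_neg_distrib, mul_add, Finset.sum_add_distrib, pow_zero, one_mul]
      rw [hc]
      change _ + ∑ d, IsScwol.homCount c d * (Nat.card (B d) : ℤ) = _
      ring

variable (R Γ) in
/-- The constant module has a finite free resolution, whose Euler characteristic is the
weighting. -/
theorem exists_isFiniteFreeResolution_const [IsScwol Γ] [Finite Γ] [∀ x y : Γ, Finite (x ⟶ y)]
    [Fintype (IsoClasses Γ)] :
    ∃ (P : ProjectiveResolution (const R Γ)) (a : ℕ → IsoClasses Γ → ℕ) (N : ℕ),
      IsFiniteFreeResolution P a N ∧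
      IsScwol.IsWeighting fun d => ∑ n ∈ Finset.range N, (-1) ^ n * (a n d : ℤ) := by
  have b : Module.Basis PUnit.{u + 1} R (ULift.{u} R) :=
    (Module.Basis.singleton PUnit R).map ULift.moduleEquiv.symm
  obtain ⟨P, a, N, hP, h⟩ := exists_isFiniteFreeResolution (R := R) (Γ := Γ) (Nat.card Γ)
    (const R Γ) (fun _ => PUnit) (fun _ => b) (fun c hc => by
      have := IsScwol.height_pos c.out
      omega)
  exact ⟨P, a, N, hP, fun c => (h c).trans (by simp)⟩

end CatModule

/-! ### The Euler characteristic of a finite scwol -/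

theorem CatModule.IsFiniteFreeResolution.isFiniteResolution {R : Type w} [CommRing R] {Γ : Type u}
    [SmallCategory Γ] {P : ProjectiveResolution (CatModule.const R Γ)}
    {a : ℕ → IsoClasses Γ → ℕ} {N : ℕ} (hP : CatModule.IsFiniteFreeResolution P a N) :
    IsFiniteResolution P :=
  ⟨fun n => by
    obtain ⟨C, hC, ⟨e⟩, -⟩ := hP.1 n
    exact CatModule.isFG_of_iso_free hC e, N, fun n hn => hP.2 n hn.le⟩

theorem CatModule.subsingleton_splitting_of_isZero {R : Type w} [CommRing R] {Γ : Type u}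
    [SmallCategory Γ] {M : CatModule R Γ} (h : Limits.IsZero M) (x : Γ) :
    Subsingleton ((CatModule.splitting x).obj M) :=
  ModuleCat.subsingleton_of_isZero ((CatModule.splitting x).map_isZero h)

/-- The Euler characteristic may be computed from any finite projective resolution. -/
theorem functorialEulerCharOf_eq {R : Type w} [CommRing R] {Γ : Type u} [SmallCategory Γ]
    [IsScwol Γ] [∀ x y : Γ, Finite (x ⟶ y)] (rank : RankFunction.{u, w} R)
    {P Q : ProjectiveResolution (CatModule.const R Γ)} (hP : IsFiniteResolution P)
    {a : ℕ → IsoClasses Γ → ℕ} {N : ℕ} (hQ : CatModule.IsFiniteFreeResolution Q a N)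
    (c : IsoClasses Γ) :
    functorialEulerCharOf rank P c = ∑ n ∈ Finset.range N, (-1) ^ n * (a n c : ℤ) := by
  obtain ⟨hPfg, d, hPd⟩ := hP
  let S := CatModule.splitting (R := R) c.out
  have hPfin : ∀ n, Module.Finite R (S.obj (P.complex.X n)) := fun n =>
    CatModule.finite_splitting_of_isFG (hPfg n) _
  have hQfin : ∀ n, Module.Finite R (S.obj (Q.complex.X n)) := fun n =>
    CatModule.finite_splitting_of_isFG (hQ.isFiniteResolution.1 n) _
  have hP0 : ∀ n, N + d + 1 ≤ n → Subsingleton (S.obj (P.complex.X n)) := fun n hn =>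
    CatModule.subsingleton_splitting_of_isZero (hPd n (by omega)) _
  have hQ0 : ∀ n, N ≤ n → Subsingleton (S.obj (Q.complex.X n)) := fun n hn =>
    CatModule.subsingleton_splitting_of_isZero (hQ.2 n hn) _
  have hrkP : ∀ n, rank.rk (CatModule.splittingTensor c.out (P.complex.X n)) =
      rank.rk (S.obj (P.complex.X n)) := fun n =>
    (rank.rk_congr (CatModule.splittingTensorEquiv c.out (P.complex.X n)).symm).symm
  have hrkQ : ∀ n, rank.rk (S.obj (Q.complex.X n)) = a n c := fun n => by
    obtain ⟨C, hC, ⟨e⟩, ha⟩ := hQ.1 n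
    have := CatModule.finite_freeIndex hC c.out
    rw [← ha]
    exact rank.rk_of_equiv_finsupp
      ((S.mapIso e).toLinearEquiv.trans (CatModule.splittingFreeEquiv c.out C))
  -- beyond degree `N + d` both complexes vanish, so all sums may be truncated there
  unfold functorialEulerCharOf
  rw [finsum_eq_sum_of_support_subset (s := Finset.range (N + d + 1))]
  · simp only [hrkP]
    refine (rank.alternating_sum_eq_of_homotopyEquiv
      (S.mapHomotopyEquiv (P.homotopyEquiv Q)) hPfin hQfin (N + d + 1) hP0
      (fun n hn => hQ0 n (by omega))).trans ?_
    change ∑ n ∈ _, (-1) ^ n * rank.rk (S.obj (Q.complex.X n)) = _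
    have hsub : Finset.range N ⊆ Finset.range (N + d + 1) :=
      Finset.range_subset_range.2 (by omega)
    rw [← Finset.sum_subset hsub fun n _ hn => ?_]
    · simp only [hrkQ]
    · have := hQ0 n (by simpa using hn)
      rw [show rank.rk (S.obj (Q.complex.X n)) = 0 from
        rank.rk_of_subsingleton (S.obj (Q.complex.X n)), mul_zero]
  · intro n hn
    rw [Finset.coe_range, Set.mem_Iio]
    by_contra hle
    have := hP0 n (by omega)
    exact hn (by
      change (-1) ^ n * rank.rk (CatModule.splittingTensor c.out (P.complex.X n)) = 0
      rw [hrkP, show rank.rk (S.obj (P.complex.X n)) = 0 from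
        rank.rk_of_subsingleton (S.obj (P.complex.X n)), mul_zero])

/-! ### The Euler–Poincaré formula and the `L²`-Euler characteristic -/

/-- The alternating sum of the dimensions of the homology spaces, truncated at `N`, differs from
that of the dimensions of the chain spaces by the rank of the differential at `N`. -/
theorem ChainComplex.sum_finrank_homology {K : Type*} [Field K]
    (C : ChainComplex (ModuleCat.{v} K) ℕ)
    [∀ n, Module.Finite K (C.X n)] (N : ℕ) :
    ∑ n ∈ Finset.range N, (-1) ^ n * (Module.finrank K (C.homology n) : ℤ) =
      ∑ n ∈ Finset.range N, (-1) ^ n * (Module.finrank K (C.X n) : ℤ) + (-1) ^ N *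
        Module.finrank K (LinearMap.range (C.d N ((ComplexShape.down ℕ).next N)).hom) := by
  have key : ∀ n, Module.finrank K (C.homology n) +
      Module.finrank K (LinearMap.range (C.d (n + 1) n).hom) +
      Module.finrank K (LinearMap.range (C.d n ((ComplexShape.down ℕ).next n)).hom) =
        Module.finrank K (C.X n) := fun n => by
    let T := C.sc' (n + 1) n ((ComplexShape.down ℕ).next n)
    have : Module.Finite K T.X₂ := inferInstanceAs (Module.Finite K (C.X n))
    have e : C.homology n ≅ T.homology := C.homologyIsoSc' (n + 1) n _ (by simp) rfl
    have h1 : Module.finrank K (C.homology n) = 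
        Module.finrank K (LinearMap.ker T.g.hom ⧸ LinearMap.range T.moduleCatToCycles) :=
      (e ≪≫ T.moduleCatHomologyIso).toLinearEquiv.finrank_eq
    have h2 := (LinearMap.range T.moduleCatToCycles).finrank_quotient_add_finrank
    have h3 : Module.finrank K (LinearMap.range T.moduleCatToCycles) =
        Module.finrank K (LinearMap.range T.f.hom) := by
      rw [← Submodule.finrank_map_subtype_eq, ← LinearMap.range_comp]
      rfl
    have h4 := T.g.hom.finrank_range_add_finrank_ker
    have h5 : Module.finrank K (LinearMap.range T.f.hom) =
      Module.finrank K (LinearMap.range (C.d (n + 1) n).hom) := rfl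
    have h6 : Module.finrank K (LinearMap.range T.g.hom) = Module.finrank K
      (LinearMap.range (C.d n ((ComplexShape.down ℕ).next n)).hom) := rfl
    have h7 : Module.finrank K T.X₂ = Module.finrank K (C.X n) := rfl
    omega
  induction N with
  | zero =>
    have h0 : C.d 0 ((ComplexShape.down ℕ).next 0) = 0 := C.shape _ _ (by simp)
    rw [h0, ModuleCat.hom_zero, LinearMap.range_zero]
    simp
  | succ N ih =>
    rw [Finset.sum_range_succ, Finset.sum_range_succ, ih, ← key N]
    have : (ComplexShape.down ℕ).next (N + 1) = N := by simp
    rw [this]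
    push_cast
    ring

theorem ChainComplex.finite_homology {K : Type*} [Field K]
    (C : ChainComplex (ModuleCat.{v} K) ℕ) (n : ℕ) [Module.Finite K (C.X n)] :
    Module.Finite K (C.homology n) := by
  have : Module.Finite K (C.sc n).X₂ := inferInstanceAs (Module.Finite K (C.X n))
  have : Module.Finite K (LinearMap.ker (C.sc n).g.hom) := inferInstance
  have : Module.Finite K (C.sc n).moduleCatLeftHomologyData.H :=
    Module.Finite.of_surjective _ (LinearMap.range (C.sc n).moduleCatToCycles).mkQ_surjective
  exact Module.Finite.equiv (C.sc n).moduleCatHomologyIso.symm.toLinearEquiv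

section L2

variable {Γ : Type u} [SmallCategory Γ]

/-- The complex whose homology defines the `L²`-Betti numbers. -/
abbrev splitComplex (Q : ProjectiveResolution (CatModule.const ℂ Γ)) (x : Γ) :
    ChainComplex (ModuleCat.{u} ℂ) ℕ :=
  ((CatModule.splitting (R := ℂ) x).mapHomologicalComplex _).obj Q.complex

theorem finite_splitComplex [∀ x y : Γ, Finite (x ⟶ y)]
    {Q : ProjectiveResolution (CatModule.const ℂ Γ)} (hQ : IsFiniteResolution Q) (x : Γ) (n : ℕ) :
    Module.Finite ℂ ((splitComplex Q x).X n) :=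
  CatModule.finite_splitting_of_isFG (hQ.1 n) x

variable [IsScwol Γ]

/-- The `L²`-Betti numbers do not depend on the resolution, any two being homotopy equivalent. As
automorphism groups in a scwol are trivial, they are dimensions of complex vector spaces. -/
theorem l2Betti_eq_finrank (P Q : ProjectiveResolution (CatModule.const ℂ Γ)) (x : Γ) (n : ℕ)
    [Module.Finite ℂ ((splitComplex Q x).X n)] :
    l2Betti P x n = (Module.finrank ℂ ((splitComplex Q x).homology n) : ℕ) := by
  have hfin := ChainComplex.finite_homology (splitComplex Q x) n
  have hcard : Nat.card (Aut x) = 1 := by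
    have : Unique (Aut x) := ⟨⟨1⟩, fun a => Iso.ext
      ((IsScwol.endo_eq_id x a.hom).trans (IsScwol.endo_eq_id x (1 : Aut x).hom).symm)⟩
    exact Nat.card_unique
  have e : (splitComplex P x).homology n ≅ (splitComplex Q x).homology n :=
    (((CatModule.splitting (R := ℂ) x).mapHomotopyEquiv (P.homotopyEquiv Q))).toHomologyIso n
  have hrank : Module.rank ℂ ((splitComplex P x).homology n) =
      Module.finrank ℂ ((splitComplex Q x).homology n) := by
    rw [e.toLinearEquiv.rank_eq, Module.finrank_eq_rank]
  unfold l2Betti vonNeumannDim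
  rw [hcard]
  refine (congrArg (fun r : Cardinal => (r.toENat : ℝ≥0∞) / ((1 : ℕ) : ℝ≥0∞)) hrank).trans ?_
  rw [Cardinal.toENat_nat, ENat.toENNReal_coe, Nat.cast_one, div_one]

variable [∀ x y : Γ, Finite (x ⟶ y)] {Q : ProjectiveResolution (CatModule.const ℂ Γ)}
  {a : ℕ → IsoClasses Γ → ℕ} {N : ℕ}

theorem l2Betti_eq_zero (hQ : CatModule.IsFiniteFreeResolution Q a N)
    (P : ProjectiveResolution (CatModule.const ℂ Γ)) (x : Γ) {n : ℕ} (hn : N ≤ n) :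
    l2Betti P x n = 0 := by
  have := finite_splitComplex hQ.isFiniteResolution x n
  have h0 : Limits.IsZero ((splitComplex Q x).X n) :=
    (CatModule.splitting (R := ℂ) x).map_isZero (hQ.2 n hn)
  have h1 : Limits.IsZero ((splitComplex Q x).homology n) :=
    (HomologicalComplex.ExactAt.of_isZero h0).isZero_homology
  have := ModuleCat.subsingleton_of_isZero h1
  rw [l2Betti_eq_finrank P Q, Module.finrank_zero_of_subsingleton, Nat.cast_zero]

/-- Only finitely many `L²`-Betti numbers of a finite scwol are nonzero, and these are finite. -/
theorem isL2Resolution [Finite Γ] (hQ : CatModule.IsFiniteFreeResolution Q a N)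
    (P : ProjectiveResolution (CatModule.const ℂ Γ)) : IsL2Resolution P := by
  have := Fintype.ofFinite (IsoClasses Γ)
  unfold IsL2Resolution
  rw [tsum_fintype]
  refine ENNReal.sum_lt_top.2 fun c _ => ?_
  rw [tsum_eq_sum (s := Finset.range N) fun n hn =>
    l2Betti_eq_zero hQ P _ (by simpa using hn)]
  refine ENNReal.sum_lt_top.2 fun n _ => ?_
  have := finite_splitComplex hQ.isFiniteResolution c.out n
  rw [l2Betti_eq_finrank P Q]
  exact ENNReal.natCast_lt_top _

/-- The functorial `L²`-Euler characteristic counts generators of a finite free resolution, by the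
Euler–Poincaré formula. -/
theorem functorialL2EulerCharOf_eq (hQ : CatModule.IsFiniteFreeResolution Q a N)
    (P : ProjectiveResolution (CatModule.const ℂ Γ)) (c : IsoClasses Γ) :
    functorialL2EulerCharOf P c = ((∑ n ∈ Finset.range N, (-1) ^ n * (a n c : ℤ) : ℤ) : ℝ) := by
  have hfin : ∀ n, Module.Finite ℂ ((splitComplex Q c.out).X n) :=
    finite_splitComplex hQ.isFiniteResolution c.out
  have hX : ∀ n, Module.finrank ℂ ((splitComplex Q c.out).X n) = a n c := fun n => by
    obtain ⟨C, hC, ⟨e⟩, ha⟩ := hQ.1 n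
    rw [← ha]
    have := (((CatModule.splitting c.out).mapIso e).toLinearEquiv.trans
      (CatModule.splittingFreeEquiv c.out C)).finrank_eq
    exact this.trans (Module.finrank_eq_nat_card_basis Finsupp.basisSingleOne)
  have hN : Module.finrank ℂ (LinearMap.range
      ((splitComplex Q c.out).d N ((ComplexShape.down ℕ).next N)).hom) = 0 := by
    have : Subsingleton ((splitComplex Q c.out).X N) :=
      CatModule.subsingleton_splitting_of_isZero (hQ.2 N le_rfl) _
    have := (LinearMap.surjective_rangeRestrict
      ((splitComplex Q c.out).d N ((ComplexShape.down ℕ).next N)).hom).subsingleton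
    exact Module.finrank_zero_of_subsingleton
  unfold functorialL2EulerCharOf
  rw [tsum_eq_sum (s := Finset.range N) fun n hn => by
    rw [l2Betti_eq_zero hQ P _ (by simpa using hn)]; simp]
  have h := ChainComplex.sum_finrank_homology (splitComplex Q c.out) N
  rw [hN, Nat.cast_zero, mul_zero, add_zero] at h
  simp only [hX] at h
  rw [← h]
  push_cast
  refine Finset.sum_congr rfl fun n _ => ?_
  rw [l2Betti_eq_finrank P Q, ENNReal.toReal_natCast]

end L2

section Weighting

variable {Γ : Type u} [SmallCategory Γ] [IsScwol Γ] [Finite Γ] [∀ x y : Γ, Finite (x ⟶ y)]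
  [Fintype (IsoClasses Γ)]

theorem IsScwol.exists_isWeighting (Γ : Type u) [SmallCategory Γ] [IsScwol Γ] [Finite Γ]
    [∀ x y : Γ, Finite (x ⟶ y)] [Fintype (IsoClasses Γ)] :
    ∃ v : IsoClasses Γ → ℤ, IsWeighting v :=
  have ⟨_, _, _, _, h⟩ := CatModule.exists_isFiniteFreeResolution_const ℤ Γ
  ⟨_, h⟩

theorem IsScwol.isTypeFP (R : Type w) [CommRing R] (Γ : Type u) [SmallCategory Γ] [IsScwol Γ]
    [Finite Γ] [∀ x y : Γ, Finite (x ⟶ y)] : IsTypeFP R Γ := by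
  have := Fintype.ofFinite (IsoClasses Γ)
  obtain ⟨Q, a, N, hQ, -⟩ := CatModule.exists_isFiniteFreeResolution_const R Γ
  exact ⟨Q, hQ.isFiniteResolution⟩

theorem IsScwol.isTypeL2 (Γ : Type u) [SmallCategory Γ] [IsScwol Γ]
    [Finite Γ] [∀ x y : Γ, Finite (x ⟶ y)] : IsTypeL2 Γ := by
  have := Fintype.ofFinite (IsoClasses Γ)
  obtain ⟨Q, a, N, hQ, -⟩ := CatModule.exists_isFiniteFreeResolution_const ℂ Γ
  exact ⟨Q, isL2Resolution hQ Q⟩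

/-- The Euler characteristic of a finite scwol is the total mass of its weighting. -/
theorem IsScwol.IsWeighting.eulerChar_eq {v : IsoClasses Γ → ℤ} (hv : IsWeighting v)
    {R : Type w} [CommRing R] (rank : RankFunction.{u, w} R) :
    eulerChar R Γ rank = ∑ c, v c := by
  obtain ⟨Q, a, N, hQ, hw⟩ := CatModule.exists_isFiniteFreeResolution_const R Γ
  have h := isTypeFP R Γ
  unfold eulerChar
  rw [dif_pos h, finsum_eq_sum_of_fintype]
  refine Finset.sum_congr rfl fun c _ => ?_
  rw [functorialEulerCharOf_eq rank h.choose_spec hQ c]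
  exact congrFun (eq_of_homCount_sum_eq fun c => (hw c).trans (hv c).symm) c

/-- The `L²`-Euler characteristic of a finite scwol is the total mass of its weighting. -/
theorem IsScwol.IsWeighting.l2EulerChar_eq {v : IsoClasses Γ → ℤ} (hv : IsWeighting v) :
    l2EulerChar Γ = ((∑ c, v c : ℤ) : ℝ) := by
  obtain ⟨Q, a, N, hQ, hw⟩ := CatModule.exists_isFiniteFreeResolution_const ℂ Γ
  have h := isTypeL2 Γ
  unfold l2EulerChar
  rw [dif_pos h, tsum_fintype, Int.cast_sum]
  refine Finset.sum_congr rfl fun c _ => ?_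
  rw [functorialL2EulerCharOf_eq hQ]
  exact congrArg Int.cast (congrFun (eq_of_homCount_sum_eq fun c => (hw c).trans (hv c).symm) c)

end Weighting

/-! ### The quotient by a free action -/

namespace ScwolAction

variable {G : Type*} [Group G] {X : Type u} [SmallCategory X] (A : ScwolAction G X)

theorem projObj_act (g : G) (x : X) : A.projObj ((A.act g).obj x) = A.projObj x :=
  (Quotient.sound (s := A.objSetoid) ⟨g, rfl⟩ : A.projObj x = _).symm

theorem act_injective_of_free (hfree : A.IsFreeOnObjects) {g h : G} {x : X}
    (e : (A.act g).obj x = (A.act h).obj x) : g = h := by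
  have : h⁻¹ * g = 1 := hfree _ x (by
    rw [A.obj_mul, e, ← A.obj_mul, inv_mul_cancel, A.obj_one])
  exact (inv_mul_eq_one.1 this).symm

/-- A morphism between two translates of the same object is trivial. -/
theorem eq_of_hom_act (hfree : A.IsFreeOnObjects) {g h : G} {x : X}
    (a : (A.act g).obj x ⟶ (A.act h).obj x) : g = h := by
  refine A.act_injective_of_free hfree (x := x) ?_
  by_contra hne
  refine A.source_ne_target (h * g⁻¹) a (fun ⟨e, _⟩ => hne e) ?_
  rw [← A.obj_mul, inv_mul_cancel_right]

/-- Morphisms in the quotient by a free action lift uniquely along a lift of their source. -/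
def sigmaHomEquiv (hfree : A.IsFreeOnObjects) (x y : X) :
    (Σ g : G, (x ⟶ (A.act g).obj y)) ≃ (A.projObj x ⟶ A.projObj y) :=
  Equiv.ofBijective (fun p => ⟨A.projMor (Arrow.mk p.2), rfl, A.projObj_act p.1 y⟩) <| by
    constructor
    · rintro ⟨g, a⟩ ⟨h, b⟩ hab
      obtain ⟨k, hk⟩ := Quotient.exact (s := A.morSetoid) (congrArg Subtype.val hab)
      obtain rfl : k = 1 := hfree k x (congrArg Comma.left hk)
      rw [A.actArrow_one] at hk
      obtain rfl : g = h := A.act_injective_of_free hfree (congrArg Comma.right hk)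
      exact congrArg (Sigma.mk g) ((Arrow.mk_inj _ _).1 hk)
    · intro m
      obtain ⟨y', a, hy, ha⟩ := A.exists_hom_lift x m
      obtain ⟨g, rfl⟩ := Quotient.exact (s := A.objSetoid) hy.symm
      exact ⟨⟨g, a⟩, Subtype.ext ha.symm⟩

instance [Finite X] : Finite A.QuotientScwol := Quotient.finite _

theorem finite_quotient_hom [Finite G] [∀ x y : X, Finite (x ⟶ y)] (hfree : A.IsFreeOnObjects)
    (p q : A.QuotientScwol) : Finite (p ⟶ q) := by
  obtain ⟨x, rfl⟩ := A.exists_projObj p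
  obtain ⟨y, rfl⟩ := A.exists_projObj q
  exact Finite.of_equiv _ (A.sigmaHomEquiv hfree x y)

theorem nonempty_iso_projObj {x y : X} (e : x ≅ y) :
    Nonempty (A.projObj x ≅ A.projObj y) :=
  let a : A.projObj x ⟶ A.projObj y := A.homMk e.hom
  have := IsScwol.isIso_of_comp a (A.homMk e.inv)
  ⟨asIso a⟩

/-- Isomorphic orbits contain isomorphic objects. -/
theorem exists_iso_act [IsScwol X] (hfree : A.IsFreeOnObjects) {x y : X}
    (e : A.projObj x ≅ A.projObj y) : ∃ g : G, Nonempty (x ≅ (A.act g).obj y) := by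
  obtain ⟨g, a⟩ := (A.sigmaHomEquiv hfree x y).symm e.hom
  obtain ⟨h, b⟩ := (A.sigmaHomEquiv hfree y x).symm e.inv
  refine ⟨g, ?_⟩
  have hgh : 1 = g * h := A.eq_of_hom_act hfree (x := x)
    (eqToHom (A.obj_one x) ≫ a ≫ (A.act g).map b ≫ eqToHom (A.obj_mul g h x).symm)
  have := IsScwol.isIso_of_comp a ((A.act g).map b ≫
    eqToHom ((A.obj_mul g h x).symm.trans (by rw [← hgh, A.obj_one])))
  exact ⟨asIso a⟩

/-- A choice of a lift of each chosen representative of an isomorphism class of the quotient. -/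
def lift (e : IsoClasses A.QuotientScwol) : X := (A.exists_projObj e.out).choose

theorem projObj_lift (e : IsoClasses A.QuotientScwol) : A.projObj (A.lift e) = e.out :=
  (A.exists_projObj e.out).choose_spec.symm

/-- Up to isomorphism, every object of `X` is in a unique way a translate of one of the chosen
lifts. -/
def isoClassesEquiv [IsScwol X] (hfree : A.IsFreeOnObjects) :
    IsoClasses A.QuotientScwol × G ≃ IsoClasses X :=
  Equiv.ofBijective
    (fun p => Quotient.mk (isIsomorphicSetoid X) ((A.act p.2).obj (A.lift p.1))) <| by
    constructor
    · rintro ⟨e, g⟩ ⟨f, h⟩ hef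
      obtain ⟨u⟩ := Quotient.exact hef
      obtain ⟨i⟩ := A.nonempty_iso_projObj u
      simp only [projObj_act, projObj_lift] at i
      obtain rfl := IsScwol.eq_of_isIso i.hom inferInstance
      obtain rfl := A.eq_of_hom_act hfree u.hom
      rfl
    · intro c
      obtain ⟨i⟩ := CatModule.nonempty_iso_out (A.projObj c.out)
      rw [← projObj_lift] at i
      obtain ⟨g, ⟨j⟩⟩ := A.exists_iso_act hfree i
      refine ⟨(Quotient.mk _ (A.projObj c.out), g), ?_⟩
      exact (Quotient.sound (s := isIsomorphicSetoid X) ⟨j.symm⟩).trans c.out_eq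

/-- The weighting of the quotient pulls back to the weighting of `X`. -/
theorem isWeighting_comp [Finite G] [IsScwol X] [∀ x y : X, Finite (x ⟶ y)]
    [Fintype (IsoClasses X)] [Fintype (IsoClasses A.QuotientScwol)] (hfree : A.IsFreeOnObjects)
    {v : IsoClasses A.QuotientScwol → ℤ} (hv : IsScwol.IsWeighting v) :
    IsScwol.IsWeighting fun c => v ((A.isoClassesEquiv hfree).symm c).1 := by
  have := Fintype.ofFinite G
  intro c
  rw [← hv (Quotient.mk (isIsomorphicSetoid A.QuotientScwol) (A.projObj c.out)),
    ← (A.isoClassesEquiv hfree).sum_comp, Fintype.sum_prod_type]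
  refine Finset.sum_congr rfl fun e _ => ?_
  simp only [Equiv.symm_apply_apply]
  rw [← Finset.sum_mul]
  congr 1
  have h1 : ∀ g : G, IsScwol.homCount c (A.isoClassesEquiv hfree (e, g)) =
      Nat.card (c.out ⟶ (A.act g).obj (A.lift e)) := fun g => by
    obtain ⟨i⟩ := CatModule.nonempty_iso_out ((A.act g).obj (A.lift e))
    exact congrArg Nat.cast (Nat.card_congr (Iso.homCongr (Iso.refl c.out) i.symm))
  obtain ⟨i⟩ := CatModule.nonempty_iso_out (A.projObj c.out)
  have h2 : IsScwol.homCount (Quotient.mk (isIsomorphicSetoid A.QuotientScwol) (A.projObj c.out)) e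
      = Nat.card (A.projObj c.out ⟶ A.projObj (A.lift e)) :=
    congrArg Nat.cast (Nat.card_congr
      (Iso.homCongr i.symm (eqToIso (A.projObj_lift e).symm)))
  simp only [h1]
  rw [h2, ← Nat.card_congr (A.sigmaHomEquiv hfree c.out (A.lift e)), Nat.card_sigma]
  push_cast
  rfl

end ScwolAction

end

theorem mainTheorem5 {G : Type*} [Group G] [Finite G]
    {X : Type u} [SmallCategory X] [IsScwol X] [Finite X] [∀ x y : X, Finite (x ⟶ y)]
    (A : ScwolAction G X) (hfree : A.IsFreeOnObjects) :
    (∀ (R : Type w) [CommRing R],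
      IsTypeFP R X ∧ IsTypeFP R A.QuotientScwol ∧
      ∀ rank : RankFunction.{u, w} R,
        (eulerChar R A.QuotientScwol rank : ℚ) = (eulerChar R X rank : ℚ) / (Nat.card G : ℚ)) ∧
    (IsTypeL2 X ∧ IsTypeL2 A.QuotientScwol ∧
      l2EulerChar A.QuotientScwol = l2EulerChar X / (Nat.card G : ℝ)) ∧
    (∀ (R : Type w) [CommRing R] (rank : RankFunction.{u, w} R),
      (eulerChar R X rank : ℝ) = l2EulerChar X ∧
      (eulerChar R A.QuotientScwol rank : ℝ) = l2EulerChar A.QuotientScwol) := by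
  have := A.finite_quotient_hom hfree
  have := Fintype.ofFinite (IsoClasses X)
  have := Fintype.ofFinite (IsoClasses A.QuotientScwol)
  have := Fintype.ofFinite G
  obtain ⟨v, hv⟩ := IsScwol.exists_isWeighting A.QuotientScwol
  have hw := A.isWeighting_comp hfree hv
  have hsum : ∑ c, v ((A.isoClassesEquiv hfree).symm c).1 = Nat.card G * ∑ e, v e := by
    rw [← (A.isoClassesEquiv hfree).sum_comp, Fintype.sum_prod_type, Finset.mul_sum]
    simp
  have hG : (Nat.card G) ≠ 0 := Nat.card_pos.ne'
  refine ⟨fun R _ => ⟨IsScwol.isTypeFP R X, IsScwol.isTypeFP R _, fun rank => ?_⟩,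
    ⟨IsScwol.isTypeL2 X, IsScwol.isTypeL2 _, ?_⟩, fun R _ rank => ⟨?_, ?_⟩⟩
  · rw [hv.eulerChar_eq, hw.eulerChar_eq, hsum, Int.cast_mul, Int.cast_natCast,
      mul_div_cancel_left₀ _ (Nat.cast_ne_zero.2 hG)]
  · rw [hv.l2EulerChar_eq, hw.l2EulerChar_eq, hsum, Int.cast_mul, Int.cast_natCast,
      mul_div_cancel_left₀ _ (Nat.cast_ne_zero.2 hG)]
  · rw [hw.eulerChar_eq, hw.l2EulerChar_eq]
  · rw [hv.eulerChar_eq, hv.l2EulerChar_eq]
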